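/- A *triangulated surface* is a finite simplicial complex triangulating a (non-empty) connected compact surface, possibly with boundary; it is *closed* if the surface has no boundary. The valence of a vertex is the number of triangles containing it. A *T-move* replaces an open triangle of a triangulation with the open star of a new 3-valent vertex (one new vertex, three new edges, three new triangles). A *root* is a closed triangulated surface to which no inverse T-move can be applied. A *decomposition* of a closed triangulated surface $\mathcal T$ is a triple $(\mathcal G,\mathcal D,\{\mathcal D_1,\dots,\mathcal D_n\})$ with $n\ge 0$, where - $\mathcal G,\mathcal D,\mathcal D_1,\dots,\mathcal D_n$ are subcomplexes of $\mathcal T$, $\mathcal G$ is a triangulated surface, and $\mathcal D,\mathcal D_1,\dots,\mathcal D_n$ are triangulated discs; - the interior of $\mathcal D$ contains a vertex whose valence in $\mathcal T$ is maximal among all vertices of $\mathcal T$; - $\mathcal G\cup\mathcal D\cup\mathcal D_1\cup\dots\cup\mathcal D_n=\mathcal T$; - the intersection of each pair of these subcomplexes is either a triangulated circle or empty. The decomposition is *minimal* if the number of triangles of $\mathcal G$ is minimal among all decompositions of $\mathcal T$. **Corollary.** If $\mathcal T$ is a root with at most $11$ vertices, then each minimal decomposition of $\mathcal T$ is either of the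 form $(\mathcal G,\mathcal D,\emptyset)$, or of the form $(\mathcal G,\mathcal D,\{\mathcal D_1\})$ where $\mathcal D_1$ consists of one or two triangles. -/

import Mathlib

/-!
Triangulated surfaces are finite (abstract) simplicial complexes, modelled by Mathlib's
`PreAbstractSimplicialComplex`: a set of nonempty finite sets of vertices ("faces") which is closed
under passing to nonempty subsets. The order `K ≤ L` is "`K` is a subcomplex of `L`", and `⊓`, `⊔`,
`⊥` are intersection, union and the empty complex.
-/

namespace PreAbstractSimplicialComplex

variable {α : Type*}

/-- The vertices of a complex. -/
def vertices (K : PreAbstractSimplicialComplex α) : Set α :=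
  {v | {v} ∈ K.faces}

/-- The edges of a complex. -/
def edges (K : PreAbstractSimplicialComplex α) : Set (Finset α) :=
  {e | e ∈ K.faces ∧ e.card = 2}

/-- The triangles of a complex. -/
def triangles (K : PreAbstractSimplicialComplex α) : Set (Finset α) :=
  {t | t ∈ K.faces ∧ t.card = 3}

/-- The valence of `v` in `K`: the number of triangles of `K` containing `v`. -/
noncomputable def valence (K : PreAbstractSimplicialComplex α) (v : α) : ℕ :=
  {t | t ∈ K.triangles ∧ v ∈ t}.ncard

/-- The number of edges of `K` containing `v`. -/
noncomputable def edgeDegree (K : PreAbstractSimplicialComplex α) (v : α) : ℕ :=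
  {e | e ∈ K.edges ∧ v ∈ e}.ncard

/-- The Euler characteristic (vertices minus edges plus triangles) of a finite complex of dimension
at most two. -/
noncomputable def eulerCharacteristic (K : PreAbstractSimplicialComplex α) : ℤ :=
  (K.vertices.ncard : ℤ) - K.edges.ncard + K.triangles.ncard

variable [DecidableEq α]

/-- `K` is nonempty and any two of its vertices are joined by a path of edges of `K`. -/
def IsConnected (K : PreAbstractSimplicialComplex α) : Prop :=
  K.vertices.Nonempty ∧
    ∀ u ∈ K.vertices, ∀ v ∈ K.vertices,
      Relation.ReflTransGen (fun x y : α => ({x, y} : Finset α) ∈ K.faces) u v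

/-- The link of a vertex `v` in `K`: the faces `s` of `K` not containing `v` such that `s ∪ {v}` is
again a face of `K`. -/
def link (K : PreAbstractSimplicialComplex α) (v : α) : PreAbstractSimplicialComplex α where
  faces := {s | s.Nonempty ∧ v ∉ s ∧ insert v s ∈ K.faces}
  isRelLowerSet_faces := by
    rintro s ⟨hs, hv, hK⟩
    refine ⟨hs, fun t hts ht => ⟨ht, fun h => hv (hts h), ?_⟩⟩
    exact (K.isRelLowerSet_faces hK).2 (Finset.insert_subset_insert v hts)
      (Finset.insert_nonempty v t)

/-- A triangulated circle: a finite connected complex of dimension at most one, each vertex of which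
lies on exactly two edges. -/
structure IsCircle (K : PreAbstractSimplicialComplex α) : Prop where
  finite : K.faces.Finite
  connected : K.IsConnected
  dim_le : ∀ s ∈ K.faces, s.card ≤ 2
  edgeDegree_eq : ∀ v ∈ K.vertices, K.edgeDegree v = 2

/-- A triangulated (nondegenerate) interval: a finite connected complex of dimension at most one,
each vertex of which lies on one or two edges, and some vertex of which lies on exactly one edge. -/
structure IsInterval (K : PreAbstractSimplicialComplex α) : Prop where
  finite : K.faces.Finite
  connected : K.IsConnected
  dim_le : ∀ s ∈ K.faces, s.card ≤ 2
  edgeDegree_eq : ∀ v ∈ K.vertices, K.edgeDegree v = 1 ∨ K.edgeDegree v = 2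
  exists_end : ∃ v ∈ K.vertices, K.edgeDegree v = 1

/-- A triangulated connected compact surface, possibly with boundary: a finite connected (hence
nonempty) complex in which the link of each vertex is a circle or an interval. -/
structure IsSurface (K : PreAbstractSimplicialComplex α) : Prop where
  finite : K.faces.Finite
  connected : K.IsConnected
  link_eq : ∀ v ∈ K.vertices, (K.link v).IsCircle ∨ (K.link v).IsInterval

/-- A vertex in the interior of a triangulated surface: its link is a circle. -/
def IsInteriorVertex (K : PreAbstractSimplicialComplex α) (v : α) : Prop :=
  v ∈ K.vertices ∧ (K.link v).IsCircle

/-- A vertex on the boundary of a triangulated surface: its link is an interval. -/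
def IsBoundaryVertex (K : PreAbstractSimplicialComplex α) (v : α) : Prop :=
  v ∈ K.vertices ∧ (K.link v).IsInterval

/-- A closed triangulated surface: a triangulated connected compact surface without boundary. -/
def IsClosedSurface (K : PreAbstractSimplicialComplex α) : Prop :=
  K.IsSurface ∧ ∀ v ∈ K.vertices, K.IsInteriorVertex v

/-- A triangulated disc. By the classification of compact surfaces, a connected compact surface is
a disc if and only if it has nonempty boundary and Euler characteristic `1`. -/
def IsDisc (K : PreAbstractSimplicialComplex α) : Prop :=
  K.IsSurface ∧ (∃ v, K.IsBoundaryVertex v) ∧ K.eulerCharacteristic = 1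

/-- `TMove K T`: the complex `T` is obtained from `K` by a T-move, i.e. by replacing an open
triangle `t` with the open star of a new 3-valent vertex `v` (the cone from `v` on the boundary
of `t`, consisting of one vertex, three edges and three triangles, is inserted). Equivalently, `K`
is obtained from `T` by an inverse T-move. -/
def TMove (K T : PreAbstractSimplicialComplex α) : Prop :=
  ∃ t ∈ K.triangles, ∃ v, v ∉ K.vertices ∧
    ∀ s : Finset α, s ∈ T.faces ↔ (s ∈ K.faces ∧ s ≠ t) ∨ ∃ r, r ⊂ t ∧ s = insert v r

/-- A root: a closed triangulated surface to which no inverse T-move can be applied. -/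
def IsRoot (T : PreAbstractSimplicialComplex α) : Prop :=
  T.IsClosedSurface ∧ ∀ K : PreAbstractSimplicialComplex α, ¬ TMove K T

/-- `v` is a vertex of `T` of maximal valence. -/
def IsMaxValenceVertex (T : PreAbstractSimplicialComplex α) (v : α) : Prop :=
  v ∈ T.vertices ∧ ∀ w ∈ T.vertices, T.valence w ≤ T.valence v

/-- The complex is a triangulated circle or empty. -/
def IsCircleOrEmpty (K : PreAbstractSimplicialComplex α) : Prop :=
  K.IsCircle ∨ K = ⊥

/-- `(G, D, {D₁, …, Dₙ})` is a decomposition of the closed triangulated surface `T`, where `Ds` is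
the set `{D₁, …, Dₙ}`; `G` is the genus-surface and `D` is the main disc. -/
structure IsDecomposition (T G D : PreAbstractSimplicialComplex α)
    (Ds : Finset (PreAbstractSimplicialComplex α)) : Prop where
  genus_le : G ≤ T
  main_le : D ≤ T
  disc_le : ∀ E ∈ Ds, E ≤ T
  genus_surface : G.IsSurface
  main_disc : D.IsDisc
  disc_disc : ∀ E ∈ Ds, E.IsDisc
  exists_maxValence : ∃ v, T.IsMaxValenceVertex v ∧ D.IsInteriorVertex v
  union_eq : G ⊔ D ⊔ sSup (Ds : Set (PreAbstractSimplicialComplex α)) = T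
  genus_inter_main : (G ⊓ D).IsCircleOrEmpty
  genus_inter_disc : ∀ E ∈ Ds, (G ⊓ E).IsCircleOrEmpty
  main_inter_disc : ∀ E ∈ Ds, (D ⊓ E).IsCircleOrEmpty
  disc_inter_disc : ∀ E ∈ Ds, ∀ F ∈ Ds, E ≠ F → (E ⊓ F).IsCircleOrEmpty

/-- A decomposition is minimal if its genus-surface has the smallest number of triangles among all
decompositions of `T`. -/
def IsMinimalDecomposition (T G D : PreAbstractSimplicialComplex α)
    (Ds : Finset (PreAbstractSimplicialComplex α)) : Prop :=
  IsDecomposition T G D Ds ∧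
    ∀ (G' D' : PreAbstractSimplicialComplex α) (Ds' : Finset (PreAbstractSimplicialComplex α)),
      IsDecomposition T G' D' Ds' → G.triangles.ncard ≤ G'.triangles.ncard

end PreAbstractSimplicialComplex

/-!
The proof distinguishes two cases by the Euler characteristic `χ` of `T`, which is at most two.

If `χ = 2`, pick a triangle not containing some vertex of maximal valence. This triangle together
with its complement is a decomposition, so the genus-surface of a minimal decomposition is a single
triangle. Every disc of the decomposition meets the genus-surface in a circle, hence contains its
three vertices; since the discs are pairwise disjoint, the main disc is the only one.

If `χ ≤ 1`, minimality is not needed. Suppose that there is a disc besides `D`, so that `T` has more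
than six vertices. As `6χ` is the sum of `6 - valence` over all vertices, some vertex has valence at
least six. The main disc contains the closed star of a vertex of maximal valence, so it has at least
seven vertices. At most four vertices remain for the other discs, each of which has at least three
vertices. Hence there is just one other disc, and Euler's formula gives it at most three triangles.
If it had three, they would form the star of a 3-valent vertex, but a root with more than four
vertices has no such vertex (`IsRoot.not_star`).

The disjointness of the discs (`IsDisc.inf_eq_bot`) and the bound `χ ≤ 2` come from homology modulo
two. Because triangles of a surface are connected through their edges
(`IsSurface.forall_triangles`), a 2-cycle is constant. Comparing dimensions gives `χ ≤ 2`, and for a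
disc, where `χ = 1` and there is a boundary, that every 1-cycle is the boundary of a 2-chain. If two
of the discs met in a circle, that circle would bound a 2-chain in each of them, which has to
consist of all triangles of that disc; so the circle would be the whole boundary of both, and the
two discs would fill up `T`, leaving no triangle for the genus-surface.
-/

/-! ### Vertices, edges and triangles at a vertex -/

namespace PreAbstractSimplicialComplex

variable {α : Type*}

lemma nonempty_of_mem_faces {K : PreAbstractSimplicialComplex α} {s : Finset α}
    (hs : s ∈ K.faces) : s.Nonempty :=
  (K.isRelLowerSet_faces hs).1

lemma mem_faces_of_subset {K : PreAbstractSimplicialComplex α} {s t : Finset α}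
    (hs : s ∈ K.faces) (hts : t ⊆ s) (ht : t.Nonempty) : t ∈ K.faces :=
  (K.isRelLowerSet_faces hs).2 hts ht

lemma mem_vertices_of_mem {K : PreAbstractSimplicialComplex α} {s : Finset α} {v : α}
    (hs : s ∈ K.faces) (hv : v ∈ s) : v ∈ K.vertices :=
  mem_faces_of_subset hs (by simpa using hv) (Finset.singleton_nonempty v)

lemma vertices_finite {K : PreAbstractSimplicialComplex α} (hK : K.faces.Finite) :
    K.vertices.Finite :=
  hK.preimage fun _ _ _ _ h => Finset.singleton_injective h

lemma edges_finite {K : PreAbstractSimplicialComplex α} (hK : K.faces.Finite) :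
    K.edges.Finite :=
  hK.subset fun _ h => h.1

lemma triangles_finite {K : PreAbstractSimplicialComplex α} (hK : K.faces.Finite) :
    K.triangles.Finite :=
  hK.subset fun _ h => h.1

lemma vertices_mono {K L : PreAbstractSimplicialComplex α} (h : K ≤ L) :
    K.vertices ⊆ L.vertices :=
  fun _ hw => h hw

variable [DecidableEq α]

/-- The vertices joined to `v` by an edge. -/
def neighbors (K : PreAbstractSimplicialComplex α) (v : α) : Set α :=
  {w | w ≠ v ∧ {v, w} ∈ K.faces}

/-- The vertices which span a triangle together with `u` and `v`; for an edge `{u, v}` they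
correspond to the triangles containing that edge. -/
def apexes (K : PreAbstractSimplicialComplex α) (u v : α) : Set α :=
  {w | w ≠ u ∧ w ≠ v ∧ {u, v, w} ∈ K.faces}

variable {K L : PreAbstractSimplicialComplex α} {u v w : α}

lemma neighbors_comm : w ∈ K.neighbors v ↔ v ∈ K.neighbors w := by
  simp only [neighbors, Set.mem_ofPred_eq, Finset.pair_comm v w, ne_comm]

lemma mem_vertices_of_neighbors (h : w ∈ K.neighbors v) : w ∈ K.vertices :=
  mem_vertices_of_mem h.2 (by simp)

lemma neighbors_mono (h : K ≤ L) : K.neighbors v ⊆ L.neighbors v :=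
  fun _ hw => ⟨hw.1, h hw.2⟩

lemma apexes_mono (h : K ≤ L) : K.apexes u v ⊆ L.apexes u v :=
  fun _ hw => ⟨hw.1, hw.2.1, h hw.2.2⟩

lemma apexes_comm : K.apexes u v = K.apexes v u := by
  ext w
  simp only [apexes, Set.mem_ofPred_eq, Finset.insert_comm u v]
  tauto

lemma mem_apexes_rotate (h : u ≠ v) : w ∈ K.apexes u v ↔ w ≠ u ∧ v ∈ K.apexes u w := by
  simp only [apexes, Set.mem_ofPred_eq, Finset.pair_comm v w]
  constructor
  · rintro ⟨h1, h2, h3⟩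
    exact ⟨h1, h.symm, h2.symm, h3⟩
  · rintro ⟨h1, h2, h3, h4⟩
    exact ⟨h1, h3.symm, h4⟩

lemma mem_triangles_of_mem_apexes (h : u ≠ v) (hw : w ∈ K.apexes u v) :
    {u, v, w} ∈ K.triangles :=
  ⟨hw.2.2, Finset.card_eq_three.2 ⟨u, v, w, h, hw.1.symm, hw.2.1.symm, rfl⟩⟩

lemma mem_edges_of_neighbors (h : v ∈ K.neighbors u) : {u, v} ∈ K.edges :=
  ⟨h.2, Finset.card_pair h.1.symm⟩

lemma eq_of_pair_eq {x y : α} (hx : x ≠ v) (h : ({v, x} : Finset α) = {v, y}) : x = y := by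
  have : x ∈ ({v, y} : Finset α) := by rw [← h]; simp
  simpa [hx] using this

lemma exists_eq_pair_of_mem_edges {e : Finset α} (he : e ∈ K.edges) (hv : v ∈ e) :
    ∃ w ∈ K.neighbors v, e = {v, w} := by
  obtain ⟨hf, hcard⟩ := he
  obtain ⟨x, y, hxy, rfl⟩ := Finset.card_eq_two.1 hcard
  rcases Finset.mem_insert.1 hv with rfl | h
  · exact ⟨y, ⟨hxy.symm, hf⟩, rfl⟩
  · obtain rfl := Finset.mem_singleton.1 h
    exact ⟨x, ⟨hxy, by rwa [Finset.pair_comm]⟩, Finset.pair_comm _ _⟩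

lemma edgeDegree_eq_ncard_neighbors : K.edgeDegree v = (K.neighbors v).ncard := by
  have himg : {e | e ∈ K.edges ∧ v ∈ e} = (fun w => ({v, w} : Finset α)) '' K.neighbors v := by
    ext e
    constructor
    · rintro ⟨he, hv⟩
      obtain ⟨w, hw, rfl⟩ := exists_eq_pair_of_mem_edges he hv
      exact ⟨w, hw, rfl⟩
    · rintro ⟨w, hw, rfl⟩
      exact ⟨mem_edges_of_neighbors hw, by simp⟩
  rw [edgeDegree, himg, Set.InjOn.ncard_image]
  intro a ha b _ hab
  exact eq_of_pair_eq ha.1 hab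

lemma vertices_link : (K.link v).vertices = K.neighbors v := by
  ext w
  simp only [vertices, link, neighbors, Set.mem_ofPred_eq, Finset.mem_singleton,
    Finset.singleton_nonempty, true_and, ne_comm, ne_eq]

lemma neighbors_link (h : u ≠ v) : (K.link u).neighbors v = K.apexes u v := by
  ext w
  simp only [neighbors, link, apexes, Set.mem_ofPred_eq, Finset.mem_insert, Finset.mem_singleton,
    Finset.insert_nonempty, true_and]
  constructor
  · rintro ⟨h1, h2, h3⟩
    exact ⟨fun h => h2 (Or.inr h.symm), h1, h3⟩
  · rintro ⟨h1, h2, h3⟩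
    refine ⟨h2, ?_, h3⟩
    rintro (h' | h')
    · exact h h'
    · exact h1 h'.symm

lemma pair_mem_link {x y : α} (h : {x, y} ∈ (K.link u).faces) (hxy : x ≠ y) :
    x ∈ K.neighbors u ∧ y ∈ K.neighbors u ∧ y ∈ K.apexes u x := by
  have hx : x ∈ (K.link u).vertices := mem_vertices_of_mem h (by simp)
  have hy : y ∈ (K.link u).vertices := mem_vertices_of_mem h (by simp)
  rw [vertices_link] at hx hy
  refine ⟨hx, hy, ?_⟩
  rw [← neighbors_link hx.1.symm]
  exact ⟨hxy.symm, h⟩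

lemma link_mono (h : K ≤ L) : K.link v ≤ L.link v :=
  fun _ hs => ⟨hs.1, hs.2.1, h hs.2.2⟩

/-! ### Connectedness -/

lemma IsConnected.vertices_subset (hK : K.IsConnected) {S : Set α} (hv : v ∈ K.vertices)
    (hvS : v ∈ S) (hS : ∀ x ∈ S, ∀ y ∈ K.neighbors x, y ∈ S) : K.vertices ⊆ S := by
  intro w hw
  induction hK.2 v hv w hw with
  | refl => exact hvS
  | @tail x y _ hxy ih =>
    have hx := ih (mem_vertices_of_mem hxy (by simp))
    by_cases h : y = x
    · rwa [h]
    · exact hS x hx y ⟨h, hxy⟩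

lemma IsCircle.ncard_neighbors (hK : K.IsCircle) (hv : v ∈ K.vertices) :
    (K.neighbors v).ncard = 2 := by
  rw [← edgeDegree_eq_ncard_neighbors, hK.edgeDegree_eq v hv]

/-- A circle has no proper subcomplex in which every vertex still has two neighbours. -/
lemma IsCircle.vertices_subset (hK : K.IsCircle) {S : Set α} (hv : v ∈ K.vertices)
    (hvS : v ∈ S)
    (hS : ∀ x ∈ S, ∃ a ∈ S, ∃ b ∈ S, a ≠ b ∧ a ∈ K.neighbors x ∧ b ∈ K.neighbors x) :
    K.vertices ⊆ S := by
  refine hK.connected.vertices_subset hv hvS fun x hx y hy => ?_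
  obtain ⟨a, ha, b, hb, hab, hax, hbx⟩ := hS x hx
  have h2 := hK.ncard_neighbors (mem_vertices_of_neighbors (neighbors_comm.1 hy))
  have hfin : (K.neighbors x).Finite := Set.finite_of_ncard_ne_zero (by omega)
  have heq : ({a, b} : Set α) = K.neighbors x := by
    refine Set.eq_of_subset_of_ncard_le ?_ (by rw [h2, Set.ncard_pair hab]) hfin
    rintro z (rfl | rfl)
    exacts [hax, hbx]
  rw [← heq] at hy
  rcases hy with rfl | rfl
  exacts [ha, hb]

/-! ### The local structure of a triangulated surface -/

lemma IsSurface.link_connected (hK : K.IsSurface) (hv : v ∈ K.vertices) :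
    (K.link v).IsConnected :=
  (hK.link_eq v hv).elim (·.connected) (·.connected)

lemma IsSurface.ncard_apexes (hK : K.IsSurface) (h : v ∈ K.neighbors u) :
    (K.apexes u v).ncard = 1 ∨ (K.apexes u v).ncard = 2 := by
  have hv : v ∈ (K.link u).vertices := by rwa [vertices_link]
  rw [← neighbors_link h.1.symm, ← edgeDegree_eq_ncard_neighbors]
  rcases hK.link_eq u (mem_vertices_of_neighbors (neighbors_comm.1 h)) with hl | hl
  · exact Or.inr (hl.edgeDegree_eq v hv)
  · exact hl.edgeDegree_eq v hv

lemma IsSurface.apexes_nonempty (hK : K.IsSurface) (h : v ∈ K.neighbors u) :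
    (K.apexes u v).Nonempty := by
  apply Set.nonempty_of_ncard_ne_zero
  rcases hK.ncard_apexes h with h | h <;> omega

lemma IsSurface.apexes_finite (hK : K.IsSurface) (h : v ∈ K.neighbors u) :
    (K.apexes u v).Finite := by
  apply Set.finite_of_ncard_ne_zero
  rcases hK.ncard_apexes h with h | h <;> omega

lemma IsSurface.neighbors_nonempty (hK : K.IsSurface) (hv : v ∈ K.vertices) :
    (K.neighbors v).Nonempty := by
  rw [← vertices_link]
  exact (hK.link_connected hv).1

lemma IsSurface.exists_apex (hK : K.IsSurface) (hv : v ∈ K.vertices) :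
    ∃ a ∈ K.neighbors v, ∃ b, b ∈ K.apexes v a := by
  obtain ⟨a, ha⟩ := hK.neighbors_nonempty hv
  exact ⟨a, ha, hK.apexes_nonempty ha⟩

lemma IsSurface.card_le (hK : K.IsSurface) {s : Finset α} (hs : s ∈ K.faces) : s.card ≤ 3 := by
  obtain ⟨v, hv⟩ := nonempty_of_mem_faces hs
  rcases (s.erase v).eq_empty_or_nonempty with h | h
  · have := Finset.card_erase_add_one hv
    rw [h] at this
    simp at this
    omega
  · have hl : s.erase v ∈ (K.link v).faces :=
      ⟨h, by simp, by rwa [Finset.insert_erase hv]⟩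
    have h2 : (s.erase v).card ≤ 2 :=
      (hK.link_eq v (mem_vertices_of_mem hs hv)).elim (·.dim_le _ hl) (·.dim_le _ hl)
    have := Finset.card_erase_add_one hv
    omega

lemma IsSurface.exists_triangle (hK : K.IsSurface) (hv : v ∈ K.vertices) :
    ∃ t ∈ K.triangles, v ∈ t := by
  obtain ⟨a, ha, b, hb⟩ := hK.exists_apex hv
  exact ⟨_, mem_triangles_of_mem_apexes ha.1.symm hb, by simp⟩

lemma IsClosedSurface.ncard_apexes (hK : K.IsClosedSurface) (h : v ∈ K.neighbors u) :
    (K.apexes u v).ncard = 2 := by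
  have hv : v ∈ (K.link u).vertices := by rwa [vertices_link]
  rw [← neighbors_link h.1.symm]
  exact (hK.2 u (mem_vertices_of_neighbors (neighbors_comm.1 h))).2.ncard_neighbors hv

lemma exists_apex_of_mem_triangles {t : Finset α} (ht : t ∈ K.triangles) :
    ∃ u v w, t = {u, v, w} ∧ v ∈ K.neighbors u ∧ w ∈ K.apexes u v := by
  obtain ⟨u, v, w, h1, h2, h3, rfl⟩ := Finset.card_eq_three.1 ht.2
  refine ⟨u, v, w, rfl, ⟨h1.symm, mem_faces_of_subset ht.1 ?_ (by simp)⟩, h2.symm, h3.symm, ht.1⟩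
  intro x
  simp
  tauto

lemma neighbors_of_mem_apexes (h : u ≠ v) (hw : w ∈ K.apexes u v) :
    v ∈ K.neighbors u ∧ w ∈ K.neighbors u ∧ w ∈ K.neighbors v := by
  refine ⟨⟨h.symm, mem_faces_of_subset hw.2.2 ?_ (by simp)⟩,
    ⟨hw.1, mem_faces_of_subset hw.2.2 ?_ (by simp)⟩,
    ⟨hw.2.1, mem_faces_of_subset hw.2.2 ?_ (by simp)⟩⟩ <;> intro x <;> simp <;> tauto

/-- The triangles of a surface are connected through common edges: a property which passes from a
triangle to the triangles sharing an edge with it holds for all triangles or for none. -/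
lemma IsSurface.forall_triangles (hK : K.IsSurface) {P : Finset α → Prop}
    (hP : ∀ u v x y, v ∈ K.neighbors u → x ∈ K.apexes u v → y ∈ K.apexes u v →
      P {u, v, x} → P {u, v, y})
    {t₀ : Finset α} (ht₀ : t₀ ∈ K.triangles) (h₀ : P t₀) : ∀ t ∈ K.triangles, P t := by
  have hlink : ∀ u v w, v ∈ K.neighbors u → w ∈ K.neighbors u →
      (∀ x ∈ K.apexes u v, P {u, v, x}) → ∀ x ∈ K.apexes u w, P {u, w, x} := by
    intro u v w hv hw hQ
    have hu : u ∈ K.vertices := mem_vertices_of_neighbors (neighbors_comm.1 hv)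
    rw [← vertices_link] at hv hw
    induction (hK.link_connected hu).2 v hv w hw with
    | refl => exact hQ
    | @tail x y _ hxy ih =>
      by_cases h : x = y
      · rw [← h] at hw ⊢
        exact ih hw
      · obtain ⟨hx, hy, hyx⟩ := pair_mem_link hxy h
        have hx' : x ∈ (K.link u).vertices := by rwa [vertices_link]
        have h1 := ih hx' y hyx
        rw [Finset.pair_comm x y] at h1
        intro z hz
        exact hP u y x z hy ((mem_apexes_rotate hx.1.symm).1 hyx).2 hz h1
  have hvert : ∀ u w, u ∈ K.vertices → w ∈ K.vertices →
      (∀ v ∈ K.neighbors u, ∀ x ∈ K.apexes u v, P {u, v, x}) →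
      ∀ v ∈ K.neighbors w, ∀ x ∈ K.apexes w v, P {w, v, x} := by
    intro u w hu hw hR
    induction hK.connected.2 u hu w hw with
    | refl => exact hR
    | @tail x y _ hxy ih =>
      have hR' := ih (mem_vertices_of_mem hxy (by simp))
      by_cases h : x = y
      · rwa [← h]
      · have hyx : y ∈ K.neighbors x := ⟨Ne.symm h, hxy⟩
        intro v hv
        refine hlink y x v (neighbors_comm.1 hyx) hv fun z hz => ?_
        rw [apexes_comm] at hz
        rw [Finset.insert_comm]
        exact hR' y hyx z hz
  obtain ⟨u, v, w, rfl, hv, hw⟩ := exists_apex_of_mem_triangles ht₀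
  have hR : ∀ v ∈ K.neighbors u, ∀ x ∈ K.apexes u v, P {u, v, x} := fun v' hv' =>
    hlink u v v' hv hv' fun x hx => hP u v w x hv hw hx h₀
  intro t ht
  obtain ⟨a, b, c, rfl, hb, hc⟩ := exists_apex_of_mem_triangles ht
  exact hvert u a (mem_vertices_of_neighbors (neighbors_comm.1 hv))
    (mem_vertices_of_neighbors (neighbors_comm.1 hb)) hR b hb c hc

end PreAbstractSimplicialComplex

/-! ### Homology with coefficients modulo two -/

section LinearAlgebra

open Module

/-- Dimension count for a three-term complex. -/
lemma finrank_add_le_of_comp_eq_zero {k A B C : Type*} [Field k]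
    [AddCommGroup A] [Module k A] [FiniteDimensional k A]
    [AddCommGroup B] [Module k B] [FiniteDimensional k B]
    [AddCommGroup C] [Module k C] [FiniteDimensional k C]
    (f : A →ₗ[k] B) (g : B →ₗ[k] C) (h : g ∘ₗ f = 0)
    (hg : finrank k C ≤ finrank k (LinearMap.range g) + 1) :
    finrank k A + finrank k C ≤ finrank k B + 1 + finrank k (LinearMap.ker f) := by
  have h1 := LinearMap.finrank_range_add_finrank_ker f
  have h2 := LinearMap.finrank_range_add_finrank_ker g
  have h3 := Submodule.finrank_mono (LinearMap.range_le_ker_iff.2 h)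
  omega

lemma range_eq_ker_of_finrank {k A B C : Type*} [Field k]
    [AddCommGroup A] [Module k A] [FiniteDimensional k A]
    [AddCommGroup B] [Module k B] [FiniteDimensional k B]
    [AddCommGroup C] [Module k C] [FiniteDimensional k C]
    (f : A →ₗ[k] B) (g : B →ₗ[k] C) (h : g ∘ₗ f = 0)
    (hg : finrank k C ≤ finrank k (LinearMap.range g) + 1)
    (hf : LinearMap.ker f = ⊥) (hdim : finrank k B + 1 ≤ finrank k A + finrank k C) :
    LinearMap.range f = LinearMap.ker g := by
  have h1 := LinearMap.finrank_range_add_finrank_ker f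
  have h2 := LinearMap.finrank_range_add_finrank_ker g
  rw [hf, finrank_bot] at h1
  exact Submodule.eq_of_le_of_finrank_le (LinearMap.range_le_ker_iff.2 h) (by omega)

end LinearAlgebra

/-- The linear map on chains modulo two given by an incidence relation `r`: the coefficient of `k`
is the sum of the coefficients of all `i` incident to `k`. -/
noncomputable def incidenceMap {ι κ : Type*} [Fintype ι] (r : κ → ι → Prop)
    [∀ k i, Decidable (r k i)] : (ι → ZMod 2) →ₗ[ZMod 2] (κ → ZMod 2) where
  toFun c k := ∑ i, if r k i then c i else 0
  map_add' c d := by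
    ext k
    simp only [Pi.add_apply, ← Finset.sum_add_distrib]
    exact Finset.sum_congr rfl fun i _ => by split_ifs <;> simp
  map_smul' a c := by
    ext k
    simp only [Pi.smul_apply, smul_eq_mul, RingHom.id_apply, Finset.mul_sum]
    exact Finset.sum_congr rfl fun i _ => by split_ifs <;> simp

lemma incidenceMap_apply {ι κ : Type*} [Fintype ι] (r : κ → ι → Prop)
    [∀ k i, Decidable (r k i)] (c : ι → ZMod 2) (k : κ) :
    incidenceMap r c k = ∑ i, if r k i then c i else 0 := rfl

lemma chain_add_self {ι : Type*} (c : ι → ZMod 2) : c + c = 0 :=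
  funext fun _ => CharTwo.add_self_eq_zero _

namespace PreAbstractSimplicialComplex

open Module

lemma eulerCharacteristic_eq_card {α : Type*} {K : PreAbstractSimplicialComplex α}
    [Fintype K.vertices] [Fintype K.edges]
    [Fintype K.triangles] :
    K.eulerCharacteristic = (finrank (ZMod 2) (K.vertices → ZMod 2) : ℤ) -
      finrank (ZMod 2) (K.edges → ZMod 2) + finrank (ZMod 2) (K.triangles → ZMod 2) := by
  simp only [finrank_fintype_fun_eq_card, eulerCharacteristic, Set.fintypeCard_eq_ncard]

variable {α : Type*} [DecidableEq α] {K L : PreAbstractSimplicialComplex α} {u v w : α}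

/-- The boundary map from 1-chains to 0-chains modulo two. -/
noncomputable def boundaryOne (K : PreAbstractSimplicialComplex α) [Fintype K.edges] :
    (K.edges → ZMod 2) →ₗ[ZMod 2] (K.vertices → ZMod 2) :=
  incidenceMap fun v e => (v : α) ∈ (e : Finset α)

/-- The boundary map from 2-chains to 1-chains modulo two. -/
noncomputable def boundaryTwo (K : PreAbstractSimplicialComplex α) [Fintype K.triangles] :
    (K.triangles → ZMod 2) →ₗ[ZMod 2] (K.edges → ZMod 2) :=
  incidenceMap fun e t => (e : Finset α) ⊆ t

lemma exists_eq_of_subset_of_mem_triangles {t : Finset α} (ht : t ∈ K.triangles) (huv : u ≠ v)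
    (h : {u, v} ⊆ t) : ∃ w ∈ K.apexes u v, t = {u, v, w} := by
  obtain ⟨w, hw⟩ : ∃ w, t \ {u, v} = {w} := by
    rw [← Finset.card_eq_one, Finset.card_sdiff_of_subset h, ht.2, Finset.card_pair huv]
  have hw' : w ∈ t \ {u, v} := by rw [hw]; simp
  have hteq : t = {u, v, w} := by
    rw [← Finset.union_sdiff_of_subset h, hw]
    ext x
    simp
  simp only [Finset.mem_sdiff, Finset.mem_insert, Finset.mem_singleton, not_or] at hw'
  exact ⟨w, ⟨hw'.2.1, hw'.2.2, hteq ▸ ht.1⟩, hteq⟩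

lemma eq_of_triple_eq {x y : α} (hx : x ≠ u) (hx' : x ≠ v)
    (h : ({u, v, x} : Finset α) = {u, v, y}) : x = y := by
  have : x ∈ ({u, v, y} : Finset α) := by rw [← h]; simp
  simpa [hx, hx'] using this

lemma boundaryOne_boundaryTwo [Fintype K.edges] [Fintype K.triangles] :
    K.boundaryOne ∘ₗ K.boundaryTwo = 0 := by
  ext c v
  simp only [LinearMap.comp_apply, LinearMap.zero_apply, Pi.zero_apply, boundaryOne, boundaryTwo,
    incidenceMap_apply]
  generalize (LinearMap.single (ZMod 2) (fun _ : K.triangles => ZMod 2) c) 1 = d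
  have : ∀ e : K.edges, (if (v : α) ∈ (e : Finset α) then
      ∑ t : K.triangles, (if (e : Finset α) ⊆ t then d t else 0) else 0) =
      ∑ t : K.triangles, if (v : α) ∈ (e : Finset α) ∧ (e : Finset α) ⊆ t then d t else 0 := by
    intro e
    by_cases h : (v : α) ∈ (e : Finset α) <;> simp [h]
  simp only [this]
  rw [Finset.sum_comm]
  refine Finset.sum_eq_zero fun t _ => ?_
  by_cases hv : (v : α) ∈ (t : Finset α)
  · obtain ⟨⟨v, hvK⟩, ⟨t, ht⟩⟩ := v, t
    simp only at hv ⊢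
    obtain ⟨a, b, hab, hte⟩ := Finset.card_eq_two.1
      (show (t.erase v).card = 2 by rw [Finset.card_erase_of_mem hv, ht.2])
    have ha : a ∈ t.erase v := by rw [hte]; simp
    have hb : b ∈ t.erase v := by rw [hte]; simp
    rw [Finset.mem_erase] at ha hb
    have hea : {v, a} ∈ K.edges := ⟨mem_faces_of_subset ht.1
      (by intro x; simp; rintro (rfl | rfl); exacts [hv, ha.2]) (by simp),
      Finset.card_pair ha.1.symm⟩
    have heb : {v, b} ∈ K.edges := ⟨mem_faces_of_subset ht.1
      (by intro x; simp; rintro (rfl | rfl); exacts [hv, hb.2]) (by simp),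
      Finset.card_pair hb.1.symm⟩
    rw [Fintype.sum_eq_add (⟨{v, a}, hea⟩ : K.edges) ⟨{v, b}, heb⟩]
    · have h1 : ({v, a} : Finset α) ⊆ t := by
        intro x; simp; rintro (rfl | rfl); exacts [hv, ha.2]
      have h2 : ({v, b} : Finset α) ⊆ t := by
        intro x; simp; rintro (rfl | rfl); exacts [hv, hb.2]
      simp [h1, h2, CharTwo.add_self_eq_zero]
    · intro h
      exact hab (eq_of_pair_eq ha.1 (Subtype.ext_iff.1 h))
    · rintro ⟨e, he⟩ ⟨h1, h2⟩
      apply if_neg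
      rintro ⟨hve, het⟩
      obtain ⟨w, hw, rfl⟩ := exists_eq_pair_of_mem_edges he hve
      have hwt : w ∈ t.erase v := Finset.mem_erase.2 ⟨hw.1, het (by simp)⟩
      rw [hte] at hwt
      rcases Finset.mem_insert.1 hwt with rfl | h
      · exact h1 rfl
      · obtain rfl := Finset.mem_singleton.1 h
        exact h2 rfl
  · exact Finset.sum_eq_zero fun e _ => if_neg fun h => hv (h.2 h.1)

lemma boundaryTwo_of_apexes_eq_pair [Fintype K.triangles] {x y : α} (h : v ∈ K.neighbors u)
    (hxy : x ≠ y) (ha : K.apexes u v = {x, y}) (c : K.triangles → ZMod 2)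
    (hx : {u, v, x} ∈ K.triangles) (hy : {u, v, y} ∈ K.triangles) :
    K.boundaryTwo c ⟨{u, v}, mem_edges_of_neighbors h⟩ = c ⟨_, hx⟩ + c ⟨_, hy⟩ := by
  have hxa : x ∈ K.apexes u v := by rw [ha]; simp
  rw [boundaryTwo, incidenceMap_apply, Fintype.sum_eq_add (⟨_, hx⟩ : K.triangles) ⟨_, hy⟩]
  · rw [if_pos (by intro z; simp; tauto), if_pos (by intro z; simp; tauto)]
  · intro h'
    exact hxy (eq_of_triple_eq hxa.1 hxa.2.1 (Subtype.ext_iff.1 h'))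
  · rintro ⟨t, ht⟩ ⟨h1, h2⟩
    apply if_neg
    intro hs
    obtain ⟨w, hw, rfl⟩ := exists_eq_of_subset_of_mem_triangles ht h.1.symm hs
    rw [ha] at hw
    rcases hw with rfl | rfl
    exacts [h1 rfl, h2 rfl]

lemma boundaryTwo_of_apexes_eq_singleton [Fintype K.triangles] {x : α} (h : v ∈ K.neighbors u)
    (ha : K.apexes u v = {x}) (c : K.triangles → ZMod 2) (hx : {u, v, x} ∈ K.triangles) :
    K.boundaryTwo c ⟨{u, v}, mem_edges_of_neighbors h⟩ = c ⟨_, hx⟩ := by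
  rw [boundaryTwo, incidenceMap_apply, Fintype.sum_eq_single (⟨_, hx⟩ : K.triangles)]
  · rw [if_pos (by intro z; simp; tauto)]
  · rintro ⟨t, ht⟩ h1
    apply if_neg
    intro hs
    obtain ⟨w, hw, rfl⟩ := exists_eq_of_subset_of_mem_triangles ht h.1.symm hs
    rw [ha] at hw
    obtain rfl := hw
    exact h1 rfl

/-- A 2-chain whose boundary vanishes on all edges lying in two triangles is constant. -/
lemma IsSurface.chain_const (hK : K.IsSurface) [Fintype K.triangles] (c : K.triangles → ZMod 2)
    (hc : ∀ u v x y, ∀ h : v ∈ K.neighbors u, x ≠ y → K.apexes u v = {x, y} →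
      K.boundaryTwo c ⟨{u, v}, mem_edges_of_neighbors h⟩ = 0) (t t' : K.triangles) :
    c t = c t' := by
  have := hK.forall_triangles (P := fun s => ∀ hs : s ∈ K.triangles, c ⟨s, hs⟩ = c t') ?_ t'.2
    (fun _ => rfl) t.1 t.2 t.2
  · exact this
  · intro u v x y huv hx hy h hs
    by_cases hxy : x = y
    · subst hxy
      exact h hs
    have heq : K.apexes u v = {x, y} := by
      symm
      refine Set.eq_of_subset_of_ncard_le ?_ ?_ (hK.apexes_finite huv)
      · rintro z (rfl | rfl)
        exacts [hx, hy]
      · rw [Set.ncard_pair hxy]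
        rcases hK.ncard_apexes huv with h | h <;> omega
    have hxt := mem_triangles_of_mem_apexes huv.1.symm hx
    have h0 := hc u v x y huv hxy heq
    rw [boundaryTwo_of_apexes_eq_pair huv hxy heq c hxt hs] at h0
    rw [← h hxt]
    exact (CharTwo.add_eq_zero.1 h0).symm

/-- The 0-boundaries of a connected complex have codimension at most one. -/
lemma IsConnected.finrank_vertices_le (hK : K.IsConnected) [Fintype K.edges]
    [Fintype K.vertices] :
    finrank (ZMod 2) (K.vertices → ZMod 2) ≤
      finrank (ZMod 2) (LinearMap.range K.boundaryOne) + 1 := by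
  classical
  obtain ⟨u, hu⟩ := hK.1
  -- Modulo boundaries, all vertices are equal to `u`.
  have key : ∀ v, ∀ hv : v ∈ K.vertices, (Pi.single ⟨v, hv⟩ 1 : K.vertices → ZMod 2) +
      Pi.single ⟨u, hu⟩ 1 ∈ LinearMap.range K.boundaryOne := by
    intro v hv
    induction hK.2 u hu v hv with
    | refl => rw [chain_add_self]; exact zero_mem _
    | @tail x y _ hxy ih =>
      have hx : x ∈ K.vertices := mem_vertices_of_mem hxy (by simp)
      by_cases h : x = y
      · subst h
        exact ih hv
      have he : {x, y} ∈ K.edges := ⟨hxy, Finset.card_pair h⟩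
      have hb : K.boundaryOne (Pi.single ⟨_, he⟩ 1) =
          Pi.single ⟨x, hx⟩ 1 + Pi.single ⟨y, hv⟩ 1 := by
        ext ⟨z, hz⟩
        rw [boundaryOne, incidenceMap_apply, Fintype.sum_eq_single ⟨_, he⟩
          (fun e he' => by rw [Pi.single_eq_of_ne he', ite_self])]
        simp only [Pi.single_eq_same, Pi.add_apply, Pi.single_apply, Subtype.mk.injEq,
          Finset.mem_insert, Finset.mem_singleton]
        by_cases h1 : z = x
        · subst h1; simp [h]
        · simp [h1]
      have := add_mem (ih hx) (LinearMap.mem_range_self K.boundaryOne (Pi.single ⟨_, he⟩ 1))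
      rw [hb] at this
      convert this using 1
      have h2 := chain_add_self (Pi.single ⟨x, hx⟩ 1 : K.vertices → ZMod 2)
      linear_combination (exp := 1) -h2
  have htop : LinearMap.range K.boundaryOne ⊔
      Submodule.span (ZMod 2) {(Pi.single ⟨u, hu⟩ 1 : K.vertices → ZMod 2)} = ⊤ := by
    rw [eq_top_iff]
    intro f _
    rw [← Finset.univ_sum_single f]
    refine Submodule.sum_mem _ fun v _ => ?_
    have hs : (Pi.single v (f v) : K.vertices → ZMod 2) = f v • Pi.single v 1 := by
      rw [← Pi.single_smul]; simp
    rw [hs]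
    refine Submodule.smul_mem _ _ ?_
    have h1 := Submodule.mem_sup_left (T := Submodule.span (ZMod 2)
      {(Pi.single ⟨u, hu⟩ 1 : K.vertices → ZMod 2)}) (key v.1 v.2)
    have h2 := Submodule.mem_sup_right (S := LinearMap.range K.boundaryOne)
      (Submodule.mem_span_singleton_self (R := ZMod 2)
        (Pi.single ⟨u, hu⟩ 1 : K.vertices → ZMod 2))
    have h3 := add_mem h1 h2
    rwa [add_assoc, chain_add_self, add_zero] at h3
  have h1 := Submodule.finrank_add_le_finrank_add_finrank (LinearMap.range K.boundaryOne)
    (Submodule.span (ZMod 2) {(Pi.single ⟨u, hu⟩ 1 : K.vertices → ZMod 2)})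
  rw [htop, finrank_top] at h1
  rw [finrank_span_singleton (by simp)] at h1
  exact h1

lemma IsSurface.exists_triangles (hK : K.IsSurface) : ∃ t, t ∈ K.triangles := by
  obtain ⟨v, hv⟩ := hK.connected.1
  obtain ⟨t, ht, -⟩ := hK.exists_triangle hv
  exact ⟨t, ht⟩

lemma IsSurface.eulerCharacteristic_le_two (hK : K.IsSurface) : K.eulerCharacteristic ≤ 2 := by
  have := (vertices_finite hK.finite).fintype
  have := (edges_finite hK.finite).fintype
  have := (triangles_finite hK.finite).fintype
  have h1 := finrank_add_le_of_comp_eq_zero _ _ boundaryOne_boundaryTwo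
    hK.connected.finrank_vertices_le
  have h2 : finrank (ZMod 2) (LinearMap.ker K.boundaryTwo) ≤ 1 := by
    obtain ⟨t, ht⟩ := hK.exists_triangles
    have h := LinearMap.finrank_le_finrank_of_injective
      (f := (LinearMap.proj (R := ZMod 2) (φ := fun _ : K.triangles => ZMod 2) ⟨t, ht⟩) ∘ₗ
        (LinearMap.ker K.boundaryTwo).subtype) ?_
    · simpa using h
    · rw [injective_iff_map_eq_zero]
      rintro ⟨c, hc⟩ h0
      ext t'
      rw [LinearMap.mem_ker] at hc
      have := hK.chain_const c (fun u v x y h _ _ => by rw [hc]; rfl) t' ⟨t, ht⟩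
      exact this.trans h0
  rw [eulerCharacteristic_eq_card]
  omega

/-- In a disc every 1-cycle modulo two is the boundary of a 2-chain. -/
lemma IsDisc.exists_boundaryTwo_eq (hK : K.IsDisc) [Fintype K.edges] [Fintype K.triangles]
    (z : K.edges → ZMod 2) (hz : K.boundaryOne z = 0) : ∃ c, K.boundaryTwo c = z := by
  have := (vertices_finite hK.1.finite).fintype
  suffices h : LinearMap.range K.boundaryTwo = LinearMap.ker K.boundaryOne by
    have : z ∈ LinearMap.range K.boundaryTwo := by rw [h]; exact hz
    exact this
  refine range_eq_ker_of_finrank _ _ boundaryOne_boundaryTwo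
    hK.1.connected.finrank_vertices_le ?_ ?_
  · -- A 2-cycle is constant, and vanishes at the triangle next to a boundary edge.
    rw [LinearMap.ker_eq_bot']
    intro c hc
    obtain ⟨v, hv, hl⟩ := hK.2.1
    obtain ⟨w, hw, hdeg⟩ := hl.exists_end
    have hwv : w ∈ K.neighbors v := by rwa [vertices_link] at hw
    rw [edgeDegree_eq_ncard_neighbors, neighbors_link hwv.1.symm, Set.ncard_eq_one] at hdeg
    obtain ⟨x, hx⟩ := hdeg
    have hxt := mem_triangles_of_mem_apexes hwv.1.symm (show x ∈ K.apexes v w by rw [hx]; rfl)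
    have h0 := boundaryTwo_of_apexes_eq_singleton hwv hx c hxt
    rw [hc] at h0
    ext t
    rw [hK.1.chain_const c (fun u v x y h _ _ => by rw [hc]; rfl) t ⟨_, hxt⟩, ← h0]
    rfl
  · have := hK.2.2
    rw [eulerCharacteristic_eq_card] at this
    omega

end PreAbstractSimplicialComplex

/-! ### Counting incidences in a closed surface -/

namespace PreAbstractSimplicialComplex

/-- Double counting of incidences between two finite sets, in terms of `Set.ncard`. -/
lemma sum_ncard_eq_sum_ncard {β γ : Type*} (A : Finset β) (B : Finset γ) (r : β → γ → Prop) :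
    ∑ a ∈ A, {b | b ∈ (B : Set γ) ∧ r a b}.ncard = ∑ b ∈ B, {a | a ∈ (A : Set β) ∧ r a b}.ncard := by
  classical
  have := Finset.sum_card_bipartiteAbove_eq_sum_card_bipartiteBelow (s := A) (t := B) r
  convert this using 2 with a _ b _
  · rw [← Set.ncard_coe_finset]; congr 1; ext; simp [Finset.bipartiteAbove]
  · rw [← Set.ncard_coe_finset]; congr 1; ext; simp [Finset.bipartiteBelow]

lemma sum_valence {α : Type*} {K : PreAbstractSimplicialComplex α} (hK : K.faces.Finite) :
    ∑ v ∈ (vertices_finite hK).toFinset, K.valence v = 3 * K.triangles.ncard := by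
  have := sum_ncard_eq_sum_ncard (vertices_finite hK).toFinset (triangles_finite hK).toFinset
    (fun v t => v ∈ t)
  simp only [Set.Finite.coe_toFinset] at this
  rw [show (∑ v ∈ (vertices_finite hK).toFinset, K.valence v) =
    ∑ v ∈ (vertices_finite hK).toFinset, {t | t ∈ K.triangles ∧ v ∈ t}.ncard from rfl, this,
    Finset.sum_const_nat (m := 3), ← Set.ncard_eq_toFinset_card _ (triangles_finite hK), mul_comm]
  intro t ht
  have ht' : t ∈ K.triangles := by simpa using ht
  rw [show {v | v ∈ K.vertices ∧ v ∈ t} = (t : Set α) from ?_, Set.ncard_coe_finset, ht'.2]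
  ext v
  exact ⟨fun h => h.2, fun h => ⟨mem_vertices_of_mem ht'.1 h, h⟩⟩

variable {α : Type*} [DecidableEq α] {K L : PreAbstractSimplicialComplex α} {u v w : α}

lemma ncard_triangles_of_edge (h : u ≠ v) :
    {t | t ∈ K.triangles ∧ {u, v} ⊆ t}.ncard = (K.apexes u v).ncard := by
  have himg : {t | t ∈ K.triangles ∧ {u, v} ⊆ t} =
      (fun w => ({u, v, w} : Finset α)) '' K.apexes u v := by
    ext t
    constructor
    · rintro ⟨ht, hs⟩
      obtain ⟨w, hw, rfl⟩ := exists_eq_of_subset_of_mem_triangles ht h hs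
      exact ⟨w, hw, rfl⟩
    · rintro ⟨w, hw, rfl⟩
      exact ⟨mem_triangles_of_mem_apexes h hw, by intro z; simp; tauto⟩
  rw [himg, Set.InjOn.ncard_image]
  intro x hx y _ hxy
  exact eq_of_triple_eq hx.1 hx.2.1 hxy

lemma IsClosedSurface.two_mul_ncard_edges (hK : K.IsClosedSurface) :
    2 * K.edges.ncard = 3 * K.triangles.ncard := by
  have hf := hK.1.finite
  have := sum_ncard_eq_sum_ncard (edges_finite hf).toFinset (triangles_finite hf).toFinset
    (fun e t => e ⊆ t)
  simp only [Set.Finite.coe_toFinset] at this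
  rw [Finset.sum_const_nat (m := 2), Finset.sum_const_nat (m := 3),
    ← Set.ncard_eq_toFinset_card _ (edges_finite hf),
    ← Set.ncard_eq_toFinset_card _ (triangles_finite hf), mul_comm, mul_comm _ 3] at this
  · exact this
  · intro t ht
    have ht' : t ∈ K.triangles := by simpa using ht
    rw [show {e | e ∈ K.edges ∧ e ⊆ t} = (t.powersetCard 2 : Set (Finset α)) from ?_,
      Set.ncard_coe_finset, Finset.card_powersetCard, ht'.2]
    · rfl
    · ext e
      simp only [edges, Set.mem_ofPred_eq, Finset.mem_coe, Finset.mem_powersetCard]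
      constructor
      · exact fun h => ⟨h.2, h.1.2⟩
      · exact fun h => ⟨⟨mem_faces_of_subset ht'.1 h.1 (Finset.card_pos.1 (by have := h.2; omega)),
          h.2⟩, h.1⟩
  · intro e he
    have he' : e ∈ K.edges := by simpa using he
    obtain ⟨x, y, hxy, rfl⟩ := Finset.card_eq_two.1 he'.2
    rw [ncard_triangles_of_edge hxy, hK.ncard_apexes ⟨hxy.symm, he'.1⟩]

/-- The combinatorial Gauss–Bonnet formula, as an inequality. -/
lemma IsClosedSurface.le_six_mul_eulerCharacteristic (hK : K.IsClosedSurface) {m : ℕ}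
    (hm : ∀ v ∈ K.vertices, K.valence v ≤ m) :
    (6 - m : ℤ) * K.vertices.ncard ≤ 6 * K.eulerCharacteristic := by
  have h1 := hK.two_mul_ncard_edges
  have h2 := sum_valence hK.1.finite
  have h3 := Finset.sum_le_card_nsmul (vertices_finite hK.1.finite).toFinset K.valence m
    (fun v hv => hm v (by simpa using hv))
  rw [← Set.ncard_eq_toFinset_card _ (vertices_finite hK.1.finite), smul_eq_mul, h2] at h3
  have h3' : (3 * K.triangles.ncard : ℤ) ≤ K.vertices.ncard * m := by exact_mod_cast h3
  have h1' : (2 * K.edges.ncard : ℤ) = 3 * K.triangles.ncard := by exact_mod_cast h1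
  rw [eulerCharacteristic]
  linarith

/-- Double counting of the pairs of a neighbour of `v` and a triangle containing it and `v`. -/
lemma IsClosedSurface.valence_eq (hK : K.IsClosedSurface) :
    K.valence v = (K.neighbors v).ncard := by
  have hf := hK.1.finite
  have hN : (K.neighbors v).Finite :=
    (vertices_finite hf).subset fun w hw => mem_vertices_of_neighbors hw
  have hT : {t | t ∈ K.triangles ∧ v ∈ t}.Finite := (triangles_finite hf).subset fun _ h => h.1
  have := sum_ncard_eq_sum_ncard hN.toFinset hT.toFinset (fun w t => w ∈ t)
  simp only [Set.Finite.coe_toFinset] at this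
  rw [Finset.sum_const_nat (m := 2), Finset.sum_const_nat (m := 2),
    ← Set.ncard_eq_toFinset_card _ hN, ← Set.ncard_eq_toFinset_card _ hT] at this
  · rw [valence]; omega
  · intro t ht
    obtain ⟨ht, hv⟩ : t ∈ K.triangles ∧ v ∈ t := by simpa using ht
    rw [show {w | w ∈ K.neighbors v ∧ w ∈ t} = (t.erase v : Set α) from ?_,
      Set.ncard_coe_finset, Finset.card_erase_of_mem hv, ht.2]
    ext w
    simp only [Set.mem_ofPred_eq, Finset.mem_coe, Finset.mem_erase]
    refine ⟨fun h => ⟨h.1.1, h.2⟩, fun h => ⟨⟨h.1, mem_faces_of_subset ht.1 ?_ (by simp)⟩, h.2⟩⟩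
    intro x
    simp only [Finset.mem_insert, Finset.mem_singleton]
    rintro (rfl | rfl)
    exacts [hv, h.2]
  · intro w hw
    have hw' : w ∈ K.neighbors v := by simpa using hw
    rw [← hK.ncard_apexes hw', ← ncard_triangles_of_edge hw'.1.symm]
    congr 1
    ext t
    simp only [Set.mem_ofPred_eq, Finset.insert_subset_iff, Finset.singleton_subset_iff, and_assoc]

lemma IsCircle.exists_neighbors (hK : K.IsCircle) (hv : v ∈ K.vertices) :
    ∃ a b, a ≠ b ∧ K.neighbors v = {a, b} :=
  Set.ncard_eq_two.1 (hK.ncard_neighbors hv)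

/-- A subcomplex contains the whole star of each of its interior vertices: the link of the vertex
in the subcomplex is a circle inside a circle. -/
lemma IsInteriorVertex.neighbors_subset (hK : K.IsClosedSurface) (hLK : L ≤ K)
    (hv : L.IsInteriorVertex v) : K.neighbors v ⊆ L.neighbors v := by
  rw [← vertices_link, ← vertices_link]
  obtain ⟨x, hx⟩ := hv.2.connected.1
  refine (hK.2 v (vertices_mono hLK hv.1)).2.vertices_subset
    (vertices_mono (link_mono hLK) hx) hx fun y hy => ?_
  obtain ⟨a, b, hab, h⟩ := hv.2.exists_neighbors hy
  have ha : a ∈ (L.link v).neighbors y := by rw [h]; simp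
  have hb : b ∈ (L.link v).neighbors y := by rw [h]; simp
  exact ⟨a, mem_vertices_of_neighbors ha, b, mem_vertices_of_neighbors hb, hab,
    neighbors_mono (link_mono hLK) ha, neighbors_mono (link_mono hLK) hb⟩

lemma IsInteriorVertex.valence_lt (hK : K.IsClosedSurface) (hLK : L ≤ K)
    (hv : L.IsInteriorVertex v) : K.valence v < L.vertices.ncard := by
  have hfin : L.vertices.Finite := (vertices_finite hK.1.finite).subset (vertices_mono hLK)
  have hN : (K.neighbors v).Finite :=
    (vertices_finite hK.1.finite).subset fun w hw => mem_vertices_of_neighbors hw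
  rw [hK.valence_eq, Nat.lt_iff_add_one_le,
    ← Set.ncard_insert_of_notMem (a := v) (fun h => h.1 rfl) hN]
  refine Set.ncard_le_ncard ?_ hfin
  rintro x (rfl | hx)
  · exact hv.1
  · exact mem_vertices_of_neighbors (hv.neighbors_subset hK hLK hx)

lemma IsSurface.three_le_ncard_vertices (hK : K.IsSurface) : 3 ≤ K.vertices.ncard := by
  obtain ⟨t, ht⟩ := hK.exists_triangles
  rw [← ht.2, ← Set.ncard_coe_finset]
  exact Set.ncard_le_ncard (fun v hv => mem_vertices_of_mem ht.1 hv) (vertices_finite hK.finite)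

/-! ### Discs in a closed surface which meet in a circle -/

/-- A circle along which a disc meets another surface without overlapping is the whole boundary of
the disc: it bounds a 2-chain of the disc, and this chain can only consist of all triangles. -/
lemma IsDisc.boundary_subset {T E F : PreAbstractSimplicialComplex α} (hT : T.IsClosedSurface)
    (hET : E ≤ T) (hFT : F ≤ T) (hE : E.IsDisc) (hF : F.IsSurface) (hC : (E ⊓ F).IsCircle)
    (h : v ∈ E.neighbors u) (h1 : (E.apexes u v).ncard = 1) : {u, v} ∈ F.faces := by
  classical
  have := (edges_finite hE.1.finite).fintype
  have := (triangles_finite hE.1.finite).fintype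
  have hno : ∀ t ∈ E.triangles, t ∉ F.faces := fun t ht htF => by
    have := hC.dim_le t ⟨ht.1, htF⟩
    rw [ht.2] at this
    omega
  -- An edge in two triangles of `E` has no room for a triangle of `F`.
  have hinner : ∀ u v x y, v ∈ E.neighbors u → x ≠ y → E.apexes u v = {x, y} →
      {u, v} ∉ F.faces := by
    intro u v x y huv hxy hxy' hfF
    obtain ⟨w, hw⟩ := hF.apexes_nonempty (⟨huv.1, hfF⟩ : v ∈ F.neighbors u)
    have huvT := neighbors_mono hET huv
    have hsub : E.apexes u v = T.apexes u v :=
      Set.eq_of_subset_of_ncard_le (apexes_mono hET)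
        (by rw [hT.ncard_apexes huvT, hxy', Set.ncard_pair hxy]) (hT.1.apexes_finite huvT)
    have hwE : w ∈ E.apexes u v := by rw [hsub]; exact apexes_mono hFT hw
    exact hno _ (mem_triangles_of_mem_apexes huv.1.symm hwE) hw.2.2
  obtain ⟨c, hc⟩ := hE.exists_boundaryTwo_eq
    (fun e => if (e : Finset α) ∈ F.faces then 1 else 0) (by
      ext ⟨v, hv⟩
      rw [boundaryOne, incidenceMap_apply]
      by_cases hvC : v ∈ (E ⊓ F).vertices
      · obtain ⟨a, b, hab, hN⟩ := hC.exists_neighbors hvC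
        have ha : a ∈ (E ⊓ F).neighbors v := by rw [hN]; simp
        have hb : b ∈ (E ⊓ F).neighbors v := by rw [hN]; simp
        have haE : a ∈ E.neighbors v := ⟨ha.1, ha.2.1⟩
        have hbE : b ∈ E.neighbors v := ⟨hb.1, hb.2.1⟩
        have haF : {v, a} ∈ F.faces := ha.2.2
        have hbF : {v, b} ∈ F.faces := hb.2.2
        rw [Fintype.sum_eq_add (⟨_, mem_edges_of_neighbors haE⟩ : E.edges)
          ⟨_, mem_edges_of_neighbors hbE⟩]
        · simp [haF, hbF, CharTwo.add_self_eq_zero]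
        · intro h
          exact hab (eq_of_pair_eq ha.1 (Subtype.ext_iff.1 h))
        · rintro ⟨e, he⟩ ⟨hea, heb⟩
          by_cases hve : v ∈ e
          · obtain ⟨w, hw, rfl⟩ := exists_eq_pair_of_mem_edges he hve
            by_cases hwF : {v, w} ∈ F.faces
            · have : w ∈ (E ⊓ F).neighbors v := ⟨hw.1, hw.2, hwF⟩
              rw [hN] at this
              rcases this with rfl | rfl
              exacts [absurd rfl hea, absurd rfl heb]
            · simp [hwF]
          · simp [hve]
      · refine Finset.sum_eq_zero fun e _ => ?_
        by_cases hve : v ∈ (e : Finset α)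
        · by_cases heF : (e : Finset α) ∈ F.faces
          · exact absurd (mem_vertices_of_mem (K := E ⊓ F) ⟨e.2.1, heF⟩ hve) hvC
          · simp [heF]
        · simp [hve])
  have hconst := hE.1.chain_const c fun u v x y huv hxy hxy' => by
    rw [hc]
    exact if_neg (hinner u v x y huv hxy hxy')
  have hval : ∀ u v, ∀ huv : v ∈ E.neighbors u, (E.apexes u v).ncard = 1 →
      ∃ t, c t = if {u, v} ∈ F.faces then 1 else 0 := by
    intro u v huv h1
    obtain ⟨x, hx⟩ := Set.ncard_eq_one.1 h1
    have hxt := mem_triangles_of_mem_apexes huv.1.symm (show x ∈ E.apexes u v by rw [hx]; rfl)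
    refine ⟨⟨_, hxt⟩, ?_⟩
    rw [← boundaryTwo_of_apexes_eq_singleton huv hx c hxt, hc]
  -- The constant value of `c` is one, as seen at an edge `{p, a}` of the circle.
  obtain ⟨p, hp⟩ := hC.connected.1
  obtain ⟨a, b, hab, hN⟩ := hC.exists_neighbors hp
  have ha : a ∈ (E ⊓ F).neighbors p := by rw [hN]; simp
  have haE : a ∈ E.neighbors p := ⟨ha.1, ha.2.1⟩
  have haF : {p, a} ∈ F.faces := ha.2.2
  have hone : (E.apexes p a).ncard = 1 := by
    refine (hE.1.ncard_apexes haE).resolve_right fun h2 => ?_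
    obtain ⟨x, y, hxy, hxy'⟩ := Set.ncard_eq_two.1 h2
    exact hinner p a x y haE hxy hxy' haF
  obtain ⟨t, ht⟩ := hval p a haE hone
  obtain ⟨t', ht'⟩ := hval u v h h1
  rw [if_pos haF] at ht
  by_contra hcon
  rw [if_neg hcon, hconst t' t, ht] at ht'
  exact one_ne_zero ht'

/-- If an edge of `T` lies in a triangle of the disc `E`, then both triangles of `T` at this edge
belong to `E` or `F`. -/
lemma IsDisc.mem_or_mem_of_apexes {T E F : PreAbstractSimplicialComplex α}
    (hT : T.IsClosedSurface) (hET : E ≤ T) (hFT : F ≤ T) (hE : E.IsDisc) (hF : F.IsSurface)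
    (hC : (E ⊓ F).IsCircle) {x y : α} (h : v ∈ T.neighbors u) (hx : x ∈ E.apexes u v)
    (hy : y ∈ T.apexes u v) : {u, v, y} ∈ E.faces ∨ {u, v, y} ∈ F.faces := by
  have huv : v ∈ E.neighbors u := (neighbors_of_mem_apexes h.1.symm hx).1
  have hT2 := hT.ncard_apexes h
  rcases hE.1.ncard_apexes huv with h1 | h2
  · have hF' := hE.boundary_subset hT hET hFT hF hC huv h1
    obtain ⟨w, hw⟩ := hF.apexes_nonempty (⟨huv.1, hF'⟩ : v ∈ F.neighbors u)
    have hxw : x ≠ w := by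
      rintro rfl
      have := hC.dim_le _ ⟨hx.2.2, hw.2.2⟩
      rw [(mem_triangles_of_mem_apexes huv.1.symm hx).2] at this
      omega
    have heq : {x, w} = T.apexes u v := by
      refine Set.eq_of_subset_of_ncard_le ?_ (by rw [hT2, Set.ncard_pair hxw])
        (hT.1.apexes_finite h)
      rintro z (rfl | rfl)
      exacts [apexes_mono hET hx, apexes_mono hFT hw]
    rw [← heq] at hy
    rcases hy with rfl | rfl
    exacts [Or.inl hx.2.2, Or.inr hw.2.2]
  · have heq : E.apexes u v = T.apexes u v :=
      Set.eq_of_subset_of_ncard_le (apexes_mono hET) (by omega) (hT.1.apexes_finite h)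
    rw [← heq] at hy
    exact Or.inl hy.2.2

/-- Two discs meeting in a circle are glued along their whole boundaries, hence cover `T`. -/
lemma IsDisc.mem_or_mem {T E F : PreAbstractSimplicialComplex α} (hT : T.IsClosedSurface)
    (hET : E ≤ T) (hFT : F ≤ T) (hE : E.IsDisc) (hF : F.IsDisc) (hC : (E ⊓ F).IsCircle) :
    ∀ t ∈ T.triangles, t ∈ E.faces ∨ t ∈ F.faces := by
  obtain ⟨t₀, ht₀⟩ := hE.1.exists_triangles
  refine hT.1.forall_triangles (P := fun t => t ∈ E.faces ∨ t ∈ F.faces) ?_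
    ⟨hET ht₀.1, ht₀.2⟩ (Or.inl ht₀.1)
  rintro u v x y huv hx hy (h | h)
  · exact hE.mem_or_mem_of_apexes hT hET hFT hF.1 hC huv ⟨hx.1, hx.2.1, h⟩ hy
  · rw [inf_comm] at hC
    exact (hF.mem_or_mem_of_apexes hT hFT hET hE.1 hC huv ⟨hx.1, hx.2.1, h⟩ hy).symm

lemma notMem_faces_of_mem_triangles {G E : PreAbstractSimplicialComplex α}
    (h : (G ⊓ E).IsCircleOrEmpty) {t : Finset α} (ht : t ∈ G.triangles) : t ∉ E.faces := by
  intro htE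
  rcases h with h | h
  · have := h.dim_le t ⟨ht.1, htE⟩
    rw [ht.2] at this
    omega
  · have : t ∈ (⊥ : PreAbstractSimplicialComplex α).faces := by rw [← h]; exact ⟨ht.1, htE⟩
    exact this

/-- Discs whose intersection with each other and with a third surface is a circle or empty are
disjoint: otherwise the two discs would already cover `T`. -/
lemma IsDisc.inf_eq_bot {T G E F : PreAbstractSimplicialComplex α} (hT : T.IsClosedSurface)
    (hGT : G ≤ T) (hET : E ≤ T) (hFT : F ≤ T) (hG : G.IsSurface) (hE : E.IsDisc) (hF : F.IsDisc)
    (hGE : (G ⊓ E).IsCircleOrEmpty) (hGF : (G ⊓ F).IsCircleOrEmpty)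
    (hEF : (E ⊓ F).IsCircleOrEmpty) : E ⊓ F = ⊥ := by
  refine hEF.resolve_left fun hC => ?_
  obtain ⟨t, ht⟩ := hG.exists_triangles
  rcases hE.mem_or_mem hT hET hFT hF hC t ⟨hGT ht.1, ht.2⟩ with h | h
  · exact notMem_faces_of_mem_triangles hGE ht h
  · exact notMem_faces_of_mem_triangles hGF ht h

end PreAbstractSimplicialComplex

/-! ### Removing an open triangle -/

namespace PreAbstractSimplicialComplex

/-- The full simplex on the vertex set `t`. -/
def simplex {α : Type*} (t : Finset α) : PreAbstractSimplicialComplex α where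
  faces := {s | s.Nonempty ∧ s ⊆ t}
  isRelLowerSet_faces := fun _ hs => ⟨hs.1, fun _ hrs hr => ⟨hr, hrs.trans hs.2⟩⟩

/-- The complex obtained from `K` by removing the single face `t`, which is maximal in `K`. -/
def eraseFacet {α : Type*} (K : PreAbstractSimplicialComplex α) (t : Finset α)
    (ht : ∀ s ∈ K.faces, t ⊆ s → s = t) : PreAbstractSimplicialComplex α where
  faces := {s | s ∈ K.faces ∧ s ≠ t}
  isRelLowerSet_faces := by
    rintro s ⟨hs, hst⟩
    refine ⟨nonempty_of_mem_faces hs, fun r hrs hr => ⟨mem_faces_of_subset hs hrs hr, ?_⟩⟩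
    rintro rfl
    exact hst (ht s hs hrs)

lemma simplex_finite {α : Type*} (t : Finset α) : (simplex t).faces.Finite :=
  (t.powerset.finite_toSet).subset fun _ hs => Finset.mem_powerset.2 hs.2

variable {α : Type*}

lemma ne_of_card_ne {s t : Finset α} (h : s.card ≠ t.card) : s ≠ t := by
  rintro rfl
  exact h rfl

lemma vertices_simplex (t : Finset α) : (simplex t).vertices = t := by
  ext v
  simp [vertices, simplex]

lemma triangles_simplex {t : Finset α} (ht : t.card = 3) : (simplex t).triangles = {t} := by
  ext s
  constructor
  · rintro ⟨h1, h2⟩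
    exact Finset.eq_of_subset_of_card_le h1.2 (by omega)
  · rintro rfl
    exact ⟨⟨Finset.card_pos.1 (by omega), subset_rfl⟩, ht⟩

section

variable {T : PreAbstractSimplicialComplex α} {t : Finset α}
  (hmax : ∀ s ∈ T.faces, t ⊆ s → s = t)

lemma vertices_eraseFacet (ht : t.card = 3) : (T.eraseFacet t hmax).vertices = T.vertices := by
  ext v
  exact and_iff_left (ne_of_card_ne (by simp [ht]))

lemma edges_eraseFacet (ht : t.card = 3) : (T.eraseFacet t hmax).edges = T.edges := by
  ext e
  exact ⟨fun h => ⟨h.1.1, h.2⟩, fun h => ⟨⟨h.1, ne_of_card_ne (by rw [h.2, ht]; simp)⟩, h.2⟩⟩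

lemma triangles_eraseFacet : (T.eraseFacet t hmax).triangles = T.triangles \ {t} := by
  ext s
  exact ⟨fun h => ⟨⟨h.1.1, h.2⟩, h.1.2⟩, fun h => ⟨⟨h.1.1, h.2⟩, h.1.2⟩⟩

end

variable [DecidableEq α] {K L C T : PreAbstractSimplicialComplex α} {u v w : α}

/-- Removing an open edge from a circle leaves an interval. It stays connected by parity: a
connected component containing only one end of the edge would have exactly one vertex of odd
degree. -/
lemma IsCircle.isInterval_of_erase (hC : C.IsCircle) {a b : α} (hab : b ∈ C.neighbors a)
    (hL : ∀ s, s ∈ L.faces ↔ s ∈ C.faces ∧ s ≠ {a, b}) : L.IsInterval := by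
  classical
  have hfin : L.faces.Finite := hC.finite.subset fun s hs => ((hL s).1 hs).1
  have hvert : L.vertices = C.vertices := by
    ext x
    refine (hL _).trans (and_iff_left fun h => ?_)
    have := congrArg Finset.card h
    rw [Finset.card_pair hab.1.symm] at this
    simp at this
  have hna : L.neighbors a = C.neighbors a \ {b} := by
    ext x
    simp only [neighbors, Set.mem_ofPred_eq, hL, Set.mem_sdiff, Set.mem_singleton_iff, and_assoc]
    refine and_congr_right fun hx => and_congr_right fun _ => not_congr ⟨fun h => ?_, fun h => ?_⟩
    · exact eq_of_pair_eq hx h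
    · rw [h]
  have hnb : L.neighbors b = C.neighbors b \ {a} := by
    ext x
    simp only [neighbors, Set.mem_ofPred_eq, hL, Set.mem_sdiff, Set.mem_singleton_iff, and_assoc]
    refine and_congr_right fun hx => and_congr_right fun _ => not_congr ⟨fun h => ?_, fun h => ?_⟩
    · rw [Finset.pair_comm a b] at h
      exact eq_of_pair_eq hx h
    · rw [h, Finset.pair_comm]
  have hno : ∀ v, v ≠ a → v ≠ b → L.neighbors v = C.neighbors v := by
    intro v hva hvb
    ext x
    simp only [neighbors, Set.mem_ofPred_eq, hL]
    refine and_congr_right fun hx => and_iff_left fun h => ?_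
    have : v ∈ ({a, b} : Finset α) := by rw [← h]; simp
    simp [hva, hvb] at this
  have ha : a ∈ C.vertices := mem_vertices_of_neighbors (neighbors_comm.1 hab)
  have hb : b ∈ C.vertices := mem_vertices_of_neighbors hab
  have hda : L.edgeDegree a = 1 := by
    rw [edgeDegree_eq_ncard_neighbors, hna, Set.ncard_sdiff_singleton_of_mem hab,
      hC.ncard_neighbors ha]
  have hdb : L.edgeDegree b = 1 := by
    rw [edgeDegree_eq_ncard_neighbors, hnb,
      Set.ncard_sdiff_singleton_of_mem (neighbors_comm.1 hab), hC.ncard_neighbors hb]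
  have hdo : ∀ v ∈ L.vertices, v ≠ a → v ≠ b → L.edgeDegree v = 2 := by
    intro v hv hva hvb
    rw [edgeDegree_eq_ncard_neighbors, hno v hva hvb, hC.ncard_neighbors (hvert ▸ hv)]
  have hsymm : ∀ x y, Relation.ReflTransGen (fun x y : α => ({x, y} : Finset α) ∈ L.faces) x y →
      Relation.ReflTransGen (fun x y : α => ({x, y} : Finset α) ∈ L.faces) y x := by
    intro x y h
    have : Std.Symm (fun x y : α => ({x, y} : Finset α) ∈ L.faces) :=
      ⟨fun x y h => by rwa [Finset.pair_comm]⟩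
    exact symm h
  have hreach : Relation.ReflTransGen (fun x y : α => ({x, y} : Finset α) ∈ L.faces) a b := by
    by_contra hcon
    let S : Set α := {x | Relation.ReflTransGen
      (fun x y : α => ({x, y} : Finset α) ∈ L.faces) a x}
    have hSV : S ⊆ L.vertices := by
      intro x hx
      cases hx with
      | refl => rwa [hvert]
      | tail _ h => exact mem_vertices_of_mem h (by simp)
    have hSfin : S.Finite := (vertices_finite hfin).subset hSV
    have hclosed : ∀ e ∈ L.edges, ∀ x ∈ e, x ∈ S → ∀ y ∈ e, y ∈ S := by
      intro e he x hx hxS y hy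
      obtain ⟨w, hw, rfl⟩ := exists_eq_pair_of_mem_edges he hx
      rcases Finset.mem_insert.1 hy with rfl | hy
      · exact hxS
      · obtain rfl := Finset.mem_singleton.1 hy
        exact Relation.ReflTransGen.tail hxS hw.2
    have hBfin : {e | e ∈ L.edges ∧ ∃ x ∈ e, x ∈ S}.Finite :=
      (edges_finite hfin).subset fun _ h => h.1
    have hcount := sum_ncard_eq_sum_ncard hSfin.toFinset hBfin.toFinset (fun x e => x ∈ e)
    simp only [Set.Finite.coe_toFinset] at hcount
    have haS : a ∈ hSfin.toFinset := by
      rw [Set.Finite.mem_toFinset]; exact Relation.ReflTransGen.refl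
    have hleft : ∀ x ∈ hSfin.toFinset,
        {e | e ∈ {e | e ∈ L.edges ∧ ∃ x ∈ e, x ∈ S} ∧ x ∈ e}.ncard = L.edgeDegree x := by
      intro x hx
      rw [Set.Finite.mem_toFinset] at hx
      rw [edgeDegree]
      congr 1
      ext e
      exact ⟨fun h => ⟨h.1.1, h.2⟩, fun h => ⟨⟨h.1, x, h.2, hx⟩, h.2⟩⟩
    -- In the component of `a` all degrees but that of `a` are two, and each edge has two ends.
    rw [Finset.sum_congr rfl hleft, ← Finset.add_sum_erase _ _ haS, hda,
      Finset.sum_const_nat (m := 2), Finset.sum_const_nat (m := 2)] at hcount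
    · omega
    · intro e he
      obtain ⟨he, x, hx, hxS⟩ := hBfin.mem_toFinset.1 he
      rw [show {y | y ∈ S ∧ y ∈ e} = (e : Set α) from ?_, Set.ncard_coe_finset, he.2]
      ext y
      exact ⟨fun h => h.2, fun h => ⟨hclosed e he x hx hxS y h, h⟩⟩
    · intro x hx
      rw [Finset.mem_erase, Set.Finite.mem_toFinset] at hx
      refine hdo x (hSV hx.2) hx.1 ?_
      rintro rfl
      exact hcon hx.2
  refine ⟨hfin, ⟨hvert ▸ hC.connected.1, ?_⟩, fun s hs => hC.dim_le s ((hL s).1 hs).1, ?_,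
    a, hvert ▸ ha, hda⟩
  · intro x hx y hy
    rw [hvert] at hx hy
    induction hC.connected.2 x hx y hy with
    | refl => exact .refl
    | @tail p q _ hpq ih =>
      refine (ih (mem_vertices_of_mem hpq (by simp))).trans ?_
      by_cases h : ({p, q} : Finset α) = {a, b}
      · have hp : p ∈ ({a, b} : Finset α) := by rw [← h]; simp
        have hq : q ∈ ({a, b} : Finset α) := by rw [← h]; simp
        simp only [Finset.mem_insert, Finset.mem_singleton] at hp hq
        rcases hp with rfl | rfl <;> rcases hq with rfl | rfl
        exacts [.refl, hreach, hsymm _ _ hreach, .refl]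
      · exact .single ((hL _).2 ⟨hpq, h⟩)
  · intro v hv
    by_cases hva : v = a
    · exact Or.inl (hva ▸ hda)
    by_cases hvb : v = b
    · exact Or.inl (hvb ▸ hdb)
    exact Or.inr (hdo v hv hva hvb)

lemma IsSurface.triangle_maximal (hK : K.IsSurface) {t : Finset α} (ht : t ∈ K.triangles) :
    ∀ s ∈ K.faces, t ⊆ s → s = t := by
  intro s hs hts
  exact (Finset.eq_of_subset_of_card_le hts (by rw [ht.2]; exact hK.card_le hs)).symm

section eraseFacet

variable {t : Finset α} (hmax : ∀ s ∈ T.faces, t ⊆ s → s = t)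

lemma link_eraseFacet_of_notMem (hv : v ∉ t) : (T.eraseFacet t hmax).link v = T.link v := by
  ext s
  refine ⟨fun h => ⟨h.1, h.2.1, h.2.2.1⟩, fun h => ⟨h.1, h.2.1, h.2.2, ?_⟩⟩
  rintro rfl
  simp at hv

lemma IsClosedSurface.isInterval_link_eraseFacet (hT : T.IsClosedSurface) (ht : t ∈ T.triangles)
    (hv : v ∈ t) : ((T.eraseFacet t hmax).link v).IsInterval := by
  obtain ⟨a, b, hab, hte⟩ := Finset.card_eq_two.1
    (show (t.erase v).card = 2 by rw [Finset.card_erase_of_mem hv, ht.2])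
  have hins : insert v {a, b} = t := by rw [← hte, Finset.insert_erase hv]
  have hva : v ∉ ({a, b} : Finset α) := by rw [← hte]; simp
  refine (hT.2 v (mem_vertices_of_mem ht.1 hv)).2.isInterval_of_erase (a := a) (b := b)
    ⟨hab.symm, by simp, hva, by rw [hins]; exact ht.1⟩ fun s => ?_
  constructor
  · rintro ⟨h1, h2, h3, h4⟩
    refine ⟨⟨h1, h2, h3⟩, ?_⟩
    rintro rfl
    exact h4 hins
  · rintro ⟨⟨h1, h2, h3⟩, h4⟩
    refine ⟨h1, h2, h3, fun h => h4 ?_⟩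
    rw [← hte, ← h, Finset.erase_insert h2]

lemma IsClosedSurface.isDisc_eraseFacet (hT : T.IsClosedSurface) (ht : t ∈ T.triangles)
    (hχ : T.eulerCharacteristic = 2) : (T.eraseFacet t hmax).IsDisc := by
  have hV := vertices_eraseFacet hmax ht.2
  obtain ⟨v, hv⟩ := nonempty_of_mem_faces ht.1
  refine ⟨⟨hT.1.finite.subset fun _ h => h.1, ⟨hV ▸ hT.1.connected.1, ?_⟩, ?_⟩,
    ⟨v, hV ▸ mem_vertices_of_mem ht.1 hv, hT.isInterval_link_eraseFacet hmax ht hv⟩, ?_⟩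
  · rw [hV]
    intro x hx y hy
    refine Relation.ReflTransGen.mono (fun p q hpq => ⟨hpq, ne_of_card_ne ?_⟩)
      x y (hT.1.connected.2 x hx y hy)
    have : ({p, q} : Finset α).card ≤ 2 := Finset.card_le_two
    rw [ht.2]
    omega
  · rw [hV]
    intro x hx
    by_cases hxt : x ∈ t
    · exact Or.inr (hT.isInterval_link_eraseFacet hmax ht hxt)
    · rw [link_eraseFacet_of_notMem hmax hxt]
      exact hT.1.link_eq x hx
  · have h1 := Set.ncard_sdiff_singleton_add_one ht (triangles_finite hT.1.finite)
    rw [eulerCharacteristic] at hχ ⊢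
    rw [hV, edges_eraseFacet hmax ht.2, triangles_eraseFacet]
    omega

end eraseFacet

lemma neighbors_simplex {t : Finset α} (hv : v ∈ t) : (simplex t).neighbors v = t.erase v := by
  ext w
  simp only [neighbors, simplex, Set.mem_ofPred_eq, Finset.insert_nonempty, true_and,
    Finset.insert_subset_iff, Finset.singleton_subset_iff, hv, Finset.coe_erase, Set.mem_sdiff,
    Finset.mem_coe, Set.mem_singleton_iff]
  tauto

lemma isConnected_of_pairs {t : Finset α} (ht : t.Nonempty) (hV : K.vertices = t)
    (h : ∀ x ∈ t, ∀ y ∈ t, {x, y} ∈ K.faces) : K.IsConnected := by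
  refine ⟨by rwa [hV, Finset.coe_nonempty], fun x hx y hy => .single (h x ?_ y ?_)⟩
  · rwa [hV] at hx
  · rwa [hV] at hy

lemma isConnected_simplex {t : Finset α} (ht : t.Nonempty) : (simplex t).IsConnected :=
  isConnected_of_pairs ht (vertices_simplex t) fun x hx y hy => ⟨by simp, by
    simp [Finset.insert_subset_iff, hx, hy]⟩

lemma isInterval_simplex {t : Finset α} (ht : t.card = 2) : (simplex t).IsInterval := by
  have hne : t.Nonempty := Finset.card_pos.1 (by omega)
  have hdeg : ∀ v ∈ t, (simplex t).edgeDegree v = 1 := by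
    intro v hv
    rw [edgeDegree_eq_ncard_neighbors, neighbors_simplex hv, Set.ncard_coe_finset,
      Finset.card_erase_of_mem hv, ht]
  obtain ⟨v, hv⟩ := hne
  refine ⟨simplex_finite t, isConnected_simplex ⟨v, hv⟩,
    fun s hs => ht ▸ Finset.card_le_card hs.2, fun x hx => Or.inl (hdeg x ?_), v, ?_, hdeg v hv⟩
  · rwa [vertices_simplex] at hx
  · rwa [vertices_simplex]

lemma link_simplex {t : Finset α} (hv : v ∈ t) : (simplex t).link v = simplex (t.erase v) := by
  ext s
  simp only [link, simplex, Set.mem_ofPred_eq, Finset.insert_nonempty, true_and,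
    Finset.insert_subset_iff, hv, Finset.subset_erase]
  tauto

lemma isSurface_simplex {t : Finset α} (ht : t.card = 3) : (simplex t).IsSurface := by
  refine ⟨simplex_finite t, isConnected_simplex (Finset.card_pos.1 (by omega)), fun v hv => ?_⟩
  rw [vertices_simplex] at hv
  rw [link_simplex hv]
  exact Or.inr (isInterval_simplex (by rw [Finset.card_erase_of_mem hv, ht]))

/-- The proper faces of a triangle form a circle. -/
lemma isCircle_of_proper_faces {t : Finset α} (ht : t.card = 3)
    (hC : ∀ s, s ∈ C.faces ↔ s.Nonempty ∧ s ⊂ t) : C.IsCircle := by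
  have hV : C.vertices = t := by
    ext v
    refine (hC {v}).trans ⟨fun h => h.2.1 (by simp), fun h => ⟨by simp, ?_⟩⟩
    exact Finset.ssubset_iff_subset_ne.2 ⟨by simpa using h, ne_of_card_ne (by simp [ht])⟩
  have hpair : ∀ x ∈ t, ∀ y ∈ t, {x, y} ∈ C.faces := by
    intro x hx y hy
    refine (hC _).2 ⟨by simp, Finset.ssubset_iff_subset_ne.2
      ⟨by simp [Finset.insert_subset_iff, hx, hy], ne_of_card_ne ?_⟩⟩
    have : ({x, y} : Finset α).card ≤ 2 := Finset.card_le_two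
    omega
  refine ⟨t.powerset.finite_toSet.subset fun s hs => Finset.mem_powerset.2 ((hC s).1 hs).2.1,
    isConnected_of_pairs (Finset.card_pos.1 (by omega)) hV hpair, fun s hs => ?_, fun v hv => ?_⟩
  · have := Finset.card_lt_card ((hC s).1 hs).2
    omega
  · have hv' : v ∈ t := by rwa [hV] at hv
    rw [edgeDegree_eq_ncard_neighbors, show C.neighbors v = (t.erase v : Finset α) from ?_,
      Set.ncard_coe_finset, Finset.card_erase_of_mem hv', ht]
    ext w
    simp only [neighbors, Set.mem_ofPred_eq, Finset.mem_coe, Finset.mem_erase]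
    refine and_congr_right fun _ => ⟨fun h => ?_, fun h => hpair v hv' w h⟩
    exact ((hC _).1 h).2.1 (by simp)

lemma IsClosedSurface.exists_triangle_notMem (hT : T.IsClosedSurface) (hv : v ∈ T.vertices) :
    ∃ t ∈ T.triangles, v ∉ t := by
  obtain ⟨a, ha, b, hb⟩ := hT.1.exists_apex hv
  have hab : b ∈ T.neighbors a := (neighbors_of_mem_apexes ha.1.symm hb).2.2
  obtain ⟨x, hx, hxv⟩ := Set.exists_ne_of_one_lt_ncard
    (show 1 < (T.apexes a b).ncard by rw [hT.ncard_apexes hab]; simp) v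
  refine ⟨_, mem_triangles_of_mem_apexes hab.1.symm hx, ?_⟩
  simp only [Finset.mem_insert, Finset.mem_singleton, not_or]
  exact ⟨ha.1.symm, hb.1.symm, hxv.symm⟩

lemma IsClosedSurface.exists_isMaxValenceVertex (hT : T.IsClosedSurface) :
    ∃ v, T.IsMaxValenceVertex v := by
  obtain ⟨v, hv, hmax⟩ := (vertices_finite hT.1.finite).exists_maximalFor T.valence _
    hT.1.connected.1
  refine ⟨v, hv, fun w hw => ?_⟩
  rcases le_total (T.valence w) (T.valence v) with h | h
  · exact h
  · exact hmax hw h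

/-- A sphere has a decomposition whose genus-surface is a single triangle and whose main disc is
everything else. -/
lemma IsClosedSurface.exists_isDecomposition_of_sphere (hT : T.IsClosedSurface)
    (hχ : T.eulerCharacteristic = 2) :
    ∃ G D : PreAbstractSimplicialComplex α, T.IsDecomposition G D ∅ ∧ G.triangles.ncard = 1 := by
  obtain ⟨v, hv⟩ := hT.exists_isMaxValenceVertex
  obtain ⟨t, ht, hvt⟩ := hT.exists_triangle_notMem hv.1
  have hmax := hT.1.triangle_maximal ht
  have hle : simplex t ≤ T := fun s hs => mem_faces_of_subset ht.1 hs.2 hs.1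
  refine ⟨simplex t, T.eraseFacet t hmax, ?_, by rw [triangles_simplex ht.2, Set.ncard_singleton]⟩
  refine ⟨hle, fun s hs => hs.1, by simp, isSurface_simplex ht.2,
    hT.isDisc_eraseFacet hmax ht hχ, by simp, ⟨v, hv, ?_, ?_⟩, ?_, Or.inl ?_, by simp, by simp,
    by simp⟩
  · rw [vertices_eraseFacet hmax ht.2]
    exact hv.1
  · rw [link_eraseFacet_of_notMem hmax hvt]
    exact (hT.2 v hv.1).2
  · rw [Finset.coe_empty, sSup_empty, sup_bot_eq]
    ext s
    constructor
    · rintro (h | h)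
      exacts [hle h, h.1]
    · intro h
      by_cases hst : s = t
      · exact Or.inl ⟨nonempty_of_mem_faces h, hst.subset⟩
      · exact Or.inr ⟨h, hst⟩
  · refine isCircle_of_proper_faces ht.2 fun s => ?_
    constructor
    · rintro ⟨h1, h2⟩
      exact ⟨h1.1, Finset.ssubset_iff_subset_ne.2 ⟨h1.2, h2.2⟩⟩
    · rintro ⟨h1, h2⟩
      exact ⟨⟨h1, h2.1⟩, hle ⟨h1, h2.1⟩, h2.ne⟩

end PreAbstractSimplicialComplex

/-! ### Decompositions of a closed surface -/

namespace PreAbstractSimplicialComplex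

lemma notMem_of_inf_eq_bot {α : Type*} {E F : PreAbstractSimplicialComplex α} (h : E ⊓ F = ⊥)
    {s : Finset α} (hs : s ∈ E.faces) : s ∉ F.faces := by
  intro hs'
  have : s ∈ (⊥ : PreAbstractSimplicialComplex α).faces := by rw [← h]; exact ⟨hs, hs'⟩
  exact this

lemma disjoint_vertices {α : Type*} {E F : PreAbstractSimplicialComplex α} (h : E ⊓ F = ⊥) : Disjoint E.vertices F.vertices :=
  Set.disjoint_left.2 fun _ hE hF => notMem_of_inf_eq_bot h hE hF

variable {α : Type*} [DecidableEq α] {K T G D E F : PreAbstractSimplicialComplex α}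
  {Ds : Finset (PreAbstractSimplicialComplex α)} {u v w : α}

namespace IsDecomposition

lemma le_of_disc (h : T.IsDecomposition G D Ds) (hE : E = D ∨ E ∈ Ds) : E ≤ T := by
  rcases hE with rfl | hE
  exacts [h.main_le, h.disc_le E hE]

lemma isDisc (h : T.IsDecomposition G D Ds) (hE : E = D ∨ E ∈ Ds) : E.IsDisc := by
  rcases hE with rfl | hE
  exacts [h.main_disc, h.disc_disc E hE]

lemma genus_inter (h : T.IsDecomposition G D Ds) (hE : E = D ∨ E ∈ Ds) :
    (G ⊓ E).IsCircleOrEmpty := by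
  rcases hE with rfl | hE
  exacts [h.genus_inter_main, h.genus_inter_disc E hE]

lemma disjoint (h : T.IsDecomposition G D Ds) (hT : T.IsClosedSurface) (hE : E = D ∨ E ∈ Ds)
    (hF : F = D ∨ F ∈ Ds) (hEF : E ≠ F) : E ⊓ F = ⊥ := by
  refine IsDisc.inf_eq_bot hT h.genus_le (h.le_of_disc hE) (h.le_of_disc hF) h.genus_surface
    (h.isDisc hE) (h.isDisc hF) (h.genus_inter hE) (h.genus_inter hF) ?_
  rcases hE with rfl | hE <;> rcases hF with rfl | hF
  · exact absurd rfl hEF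
  · exact h.main_inter_disc F hF
  · rw [inf_comm]
    exact h.main_inter_disc E hE
  · exact h.disc_inter_disc E hE F hF hEF

lemma main_ne (h : T.IsDecomposition G D Ds) (hE : E ∈ Ds) : D ≠ E := by
  rintro rfl
  obtain ⟨t, ht⟩ := h.main_disc.1.exists_triangles
  exact notMem_faces_of_mem_triangles (h.main_inter_disc D hE) ht ht.1

lemma mem_cover (h : T.IsDecomposition G D Ds) {s : Finset α} (hs : s ∈ T.faces) :
    s ∈ G.faces ∨ ∃ E, (E = D ∨ E ∈ Ds) ∧ s ∈ E.faces := by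
  rw [← h.union_eq] at hs
  rcases hs with (hs | hs) | hs
  · exact Or.inl hs
  · exact Or.inr ⟨D, Or.inl rfl, hs⟩
  · obtain ⟨E, hE, hs⟩ := Set.mem_iUnion₂.1 hs
    exact Or.inr ⟨E, Or.inr hE, hs⟩

/-- The genus-surface meets each disc, because the disc is not all of `T` and its neighbouring
triangles do not lie in another disc. -/
lemma genus_inter_isCircle (h : T.IsDecomposition G D Ds) (hT : T.IsClosedSurface)
    (hE : E = D ∨ E ∈ Ds) : (G ⊓ E).IsCircle := by
  refine (h.genus_inter hE).resolve_right fun hbot => ?_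
  obtain ⟨t₀, ht₀⟩ := (h.isDisc hE).1.exists_triangles
  have hall : ∀ t ∈ T.triangles, t ∈ E.faces := by
    refine hT.1.forall_triangles (P := fun t => t ∈ E.faces) ?_
      ⟨h.le_of_disc hE ht₀.1, ht₀.2⟩ ht₀.1
    intro u v x y huv hx hy hxE
    have huvE : {u, v} ∈ E.faces := mem_faces_of_subset hxE (by intro z; simp; tauto) (by simp)
    have hsub : ({u, v} : Finset α) ⊆ {u, v, y} := by intro z; simp; tauto
    rcases h.mem_cover hy.2.2 with hG | ⟨F, hF, hyF⟩
    · exact absurd huvE (notMem_of_inf_eq_bot hbot (mem_faces_of_subset hG hsub (by simp)))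
    · by_cases hEF : E = F
      · rwa [hEF]
      · exact absurd (mem_faces_of_subset hyF hsub (by simp))
          (notMem_of_inf_eq_bot (h.disjoint hT hE hF hEF) huvE)
  obtain ⟨t, ht⟩ := h.genus_surface.exists_triangles
  exact notMem_faces_of_mem_triangles (Or.inr hbot) ht (hall t ⟨h.genus_le ht.1, ht.2⟩)

/-- If the genus-surface is a single triangle, every disc contains all of its three vertices, so
there is no room for a second disc. -/
lemma eq_empty_of_ncard_triangles_le_one (h : T.IsDecomposition G D Ds)
    (hT : T.IsClosedSurface) (hG : G.triangles.ncard ≤ 1) : Ds = ∅ := by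
  obtain ⟨t, ht⟩ := h.genus_surface.exists_triangles
  have hGt : G.vertices ⊆ t := by
    intro v hv
    obtain ⟨t', ht', hvt⟩ := h.genus_surface.exists_triangle hv
    rwa [(Set.ncard_le_one (triangles_finite h.genus_surface.finite)).1 hG t' ht' t ht] at hvt
  have hsub : ∀ E, E = D ∨ E ∈ Ds → ∀ v ∈ t, v ∈ E.vertices := by
    intro E hE
    have hC := h.genus_inter_isCircle hT hE
    obtain ⟨p, hp⟩ := hC.connected.1
    obtain ⟨a, b, hab, hN⟩ := hC.exists_neighbors hp
    have ha : a ∈ (G ⊓ E).neighbors p := by rw [hN]; simp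
    have hb : b ∈ (G ⊓ E).neighbors p := by rw [hN]; simp
    have ha' := mem_vertices_of_neighbors ha
    have hb' := mem_vertices_of_neighbors hb
    have heq : ({p, a, b} : Finset α) = t := by
      refine Finset.eq_of_subset_of_card_le ?_ ?_
      · simp only [Finset.insert_subset_iff, Finset.singleton_subset_iff]
        exact ⟨hGt hp.1, hGt ha'.1, hGt hb'.1⟩
      · rw [ht.2, Finset.card_eq_three.2 ⟨p, a, b, ha.1.symm, hb.1.symm, hab, rfl⟩]
    rw [← heq]
    intro v hv
    simp only [Finset.mem_insert, Finset.mem_singleton] at hv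
    rcases hv with rfl | rfl | rfl
    exacts [hp.2, ha'.2, hb'.2]
  rw [Finset.eq_empty_iff_forall_notMem]
  intro E hE
  obtain ⟨v, hv⟩ := nonempty_of_mem_faces ht.1
  exact notMem_of_inf_eq_bot (h.disjoint hT (Or.inl rfl) (Or.inr hE) (h.main_ne hE))
    (hsub D (Or.inl rfl) v hv) (hsub E (Or.inr hE) v hv)

end IsDecomposition

/-! ### Discs with at most four vertices -/

/-- Euler's formula, with at most three or six edges on three or four vertices. -/
lemma IsDisc.ncard_triangles_of_ncard_vertices_le_four (hE : E.IsDisc) (hV : E.vertices.ncard ≤ 4) :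
    E.triangles.ncard = 1 ∨ E.triangles.ncard = 2 ∨
      E.triangles.ncard = 3 ∧ E.vertices.ncard = 4 := by
  have hfin := vertices_finite hE.1.finite
  have hχ := hE.2.2
  rw [eulerCharacteristic] at hχ
  have h3 := hE.1.three_le_ncard_vertices
  have hpos : 0 < E.triangles.ncard := (Set.ncard_pos (triangles_finite hE.1.finite)).2
    hE.1.exists_triangles
  have hedges : E.edges.ncard ≤ E.vertices.ncard.choose 2 := by
    rw [Set.ncard_eq_toFinset_card _ hfin, ← Finset.card_powersetCard, ← Set.ncard_coe_finset]
    refine Set.ncard_le_ncard (fun e he => ?_) (Finset.finite_toSet _)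
    rw [Finset.mem_coe, Finset.mem_powersetCard]
    exact ⟨fun x hx => hfin.mem_toFinset.2 (mem_vertices_of_mem he.1 hx), he.2⟩
  have h4 : E.vertices.ncard = 3 ∨ E.vertices.ncard = 4 := by omega
  rcases h4 with h | h
  · rw [h, show Nat.choose 3 2 = 3 from rfl] at hedges
    omega
  · rw [h, show Nat.choose 4 2 = 6 from rfl] at hedges
    omega

/-- Three triangles on four vertices are the closed star of a vertex. -/
lemma exists_star_of_ncard_triangles (hK : K.faces.Finite) (hV : K.vertices.ncard = 4)
    (hF : K.triangles.ncard = 3) : ∃ d a b c, a ≠ b ∧ a ≠ c ∧ b ≠ c ∧ d ≠ a ∧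
      b ∈ K.apexes d a ∧ c ∈ K.apexes d a ∧ c ∈ K.apexes d b := by
  have hfin := vertices_finite hK
  have hcard : hfin.toFinset.card = 4 := by rw [← Set.ncard_eq_toFinset_card _ hfin, hV]
  have hsub : (triangles_finite hK).toFinset ⊆ hfin.toFinset.powersetCard 3 := by
    intro t ht
    rw [Set.Finite.mem_toFinset] at ht
    rw [Finset.mem_powersetCard]
    exact ⟨fun x hx => hfin.mem_toFinset.2 (mem_vertices_of_mem ht.1 hx), ht.2⟩
  have hmiss : (hfin.toFinset.powersetCard 3 \ (triangles_finite hK).toFinset).card = 1 := by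
    rw [Finset.card_sdiff_of_subset hsub, Finset.card_powersetCard, hcard,
      ← Set.ncard_eq_toFinset_card _ (triangles_finite hK), hF]
    rfl
  obtain ⟨t, ht⟩ := Finset.card_eq_one.1 hmiss
  have ht' : t ∈ hfin.toFinset.powersetCard 3 \ (triangles_finite hK).toFinset := by
    rw [ht]; simp
  have hother : ∀ s ⊆ hfin.toFinset, s.card = 3 → s ≠ t → s ∈ K.faces := by
    intro s hs hs3 hst
    by_contra hcon
    have : s ∈ hfin.toFinset.powersetCard 3 \ (triangles_finite hK).toFinset := by
      rw [Finset.mem_sdiff, Finset.mem_powersetCard, Set.Finite.mem_toFinset]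
      exact ⟨⟨hs, hs3⟩, fun h => hcon h.1⟩
    rw [ht, Finset.mem_singleton] at this
    exact hst this
  -- The common vertex is the one not contained in the missing triangle `t`.
  rw [Finset.mem_sdiff, Finset.mem_powersetCard] at ht'
  obtain ⟨⟨htW, ht3⟩, -⟩ := ht'
  obtain ⟨d, hd⟩ := Finset.card_eq_one.1
    (show (hfin.toFinset \ t).card = 1 by rw [Finset.card_sdiff_of_subset htW, hcard, ht3])
  have hdW : d ∈ hfin.toFinset \ t := by rw [hd]; simp
  rw [Finset.mem_sdiff] at hdW
  have hpair : ∀ x ∈ t, ∀ y ∈ t, x ≠ y → y ∈ K.apexes d x := by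
    intro x hx y hy hxy
    have hdx : d ≠ x := by rintro rfl; exact hdW.2 hx
    have hdy : d ≠ y := by rintro rfl; exact hdW.2 hy
    refine ⟨hdy.symm, hxy.symm, hother _ ?_ ?_ ?_⟩
    · simp only [Finset.insert_subset_iff, Finset.singleton_subset_iff]
      exact ⟨hdW.1, htW hx, htW hy⟩
    · exact Finset.card_eq_three.2 ⟨d, x, y, hdx, hdy, hxy, rfl⟩
    · rintro rfl
      exact hdW.2 (by simp)
  obtain ⟨a, b, c, hab, hac, hbc, rfl⟩ := Finset.card_eq_three.1 ht3
  refine ⟨d, a, b, c, hab, hac, hbc, ?_, hpair a (by simp) b (by simp) hab,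
    hpair a (by simp) c (by simp) hac, hpair b (by simp) c (by simp) hbc⟩
  rintro rfl
  exact hdW.2 (by simp)

/-- A 3-valent vertex has only three neighbours. -/
lemma IsClosedSurface.neighbors_subset_of_star (hT : T.IsClosedSurface) {a b c d : α}
    (hab : a ≠ b) (hac : a ≠ c) (hbc : b ≠ c) (h1 : d ≠ a)
    (hb : b ∈ T.apexes d a) (hc : c ∈ T.apexes d a) (hbc' : c ∈ T.apexes d b) :
    T.neighbors d ⊆ {a, b, c} := by
  have had : a ∈ T.neighbors d := (neighbors_of_mem_apexes h1 hb).1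
  have hcb := (mem_apexes_rotate hb.1.symm).1 hbc'
  have hba := (mem_apexes_rotate h1).1 hb
  have hca := (mem_apexes_rotate h1).1 hc
  have hdT : d ∈ T.vertices := mem_vertices_of_neighbors (neighbors_comm.1 had)
  rw [← vertices_link]
  refine (hT.2 d hdT).2.vertices_subset (v := a) (by rwa [vertices_link]) (by simp) ?_
  rintro x (rfl | rfl | rfl)
  · rw [neighbors_link h1]
    exact ⟨b, by simp, c, by simp, hbc, hb, hc⟩
  · rw [neighbors_link hb.1.symm]
    exact ⟨a, by simp, c, by simp, hac, hba.2, hbc'⟩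
  · rw [neighbors_link hc.1.symm]
    exact ⟨a, by simp, b, by simp, hab, hca.2, hcb.2⟩

/-- A root with more than four vertices has no 3-valent vertex: the link of such a vertex does not
bound a triangle, as otherwise the surface would be the boundary of a tetrahedron, and so the
vertex can be removed by an inverse T-move. -/
lemma IsRoot.not_star (hT : T.IsRoot) (hV : 4 < T.vertices.ncard) {a b c d : α}
    (hab : a ≠ b) (hac : a ≠ c) (hbc : b ≠ c) (h1 : d ≠ a)
    (hb : b ∈ T.apexes d a) (hc : c ∈ T.apexes d a) (hbc' : c ∈ T.apexes d b) : False := by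
  have hclosed := hT.1
  have h2 : d ≠ b := hb.1.symm
  have h3 : d ≠ c := hc.1.symm
  have hNd := hclosed.neighbors_subset_of_star hab hac hbc h1 hb hc hbc'
  have hdab : {d, a, b} ∈ T.faces := hb.2.2
  have hdac : {d, a, c} ∈ T.faces := hc.2.2
  have hdbc : {d, b, c} ∈ T.faces := hbc'.2.2
  have hdT : d ∈ T.vertices := mem_vertices_of_mem hdab (by simp)
  by_cases habc : {a, b, c} ∈ T.faces
  · have hleft : ∀ x y z : α, ({x, y, z} : Finset α) = {y, x, z} := fun x y z =>
      Finset.insert_comm _ _ _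
    have hright : ∀ x y z : α, ({x, y, z} : Finset α) = {x, z, y} := fun x y z => by
      rw [Finset.pair_comm y z]
    have hNa : T.neighbors a ⊆ {d, b, c} :=
      hclosed.neighbors_subset_of_star h2 h3 hbc h1.symm ⟨hab.symm, h2.symm, by rwa [hleft]⟩
        ⟨hac.symm, h3.symm, by rwa [hleft]⟩ ⟨hac.symm, hbc.symm, habc⟩
    have hNb : T.neighbors b ⊆ {d, a, c} :=
      hclosed.neighbors_subset_of_star h1 h3 hac h2.symm ⟨hab, h1.symm, by rwa [hleft, hright]⟩
        ⟨hbc.symm, h3.symm, by rwa [hleft]⟩ ⟨hbc.symm, hac.symm, by rwa [hleft]⟩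
    have hNc : T.neighbors c ⊆ {d, a, b} :=
      hclosed.neighbors_subset_of_star h1 h2 hab h3.symm ⟨hac, h1.symm, by rwa [hleft, hright]⟩
        ⟨hbc, h2.symm, by rwa [hleft, hright]⟩ ⟨hbc, hab.symm, by rwa [hleft, hright]⟩
    have hsub : T.vertices ⊆ (({d, a, b, c} : Finset α) : Set α) := by
      refine hclosed.1.connected.vertices_subset hdT (by simp) fun x hx y hy => ?_
      simp only [Finset.coe_insert, Finset.coe_singleton, Set.mem_insert_iff,
        Set.mem_singleton_iff] at hx ⊢
      rcases hx with rfl | rfl | rfl | rfl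
      · have := hNd hy
        simp only [Set.mem_insert_iff, Set.mem_singleton_iff] at this
        tauto
      · have := hNa hy
        simp only [Set.mem_insert_iff, Set.mem_singleton_iff] at this
        tauto
      · have := hNb hy
        simp only [Set.mem_insert_iff, Set.mem_singleton_iff] at this
        tauto
      · have := hNc hy
        simp only [Set.mem_insert_iff, Set.mem_singleton_iff] at this
        tauto
    have := Set.ncard_le_ncard hsub (Finset.finite_toSet _)
    rw [Set.ncard_coe_finset] at this
    have : ({d, a, b, c} : Finset α).card ≤ 4 := Finset.card_le_four
    omega
  · have hstar : ∀ r : Finset α, r ⊂ {a, b, c} → insert d r ∈ T.faces := by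
      intro r hr
      obtain ⟨x, hx, hxr⟩ := Finset.exists_of_ssubset hr
      simp only [Finset.mem_insert, Finset.mem_singleton] at hx
      have hsub : ∀ y ∈ r, (y = a ∨ y = b ∨ y = c) ∧ y ≠ x := fun y hy =>
        ⟨by simpa using hr.1 hy, by rintro rfl; exact hxr hy⟩
      rcases hx with rfl | rfl | rfl
      · refine mem_faces_of_subset hdbc (fun y hy => ?_) (by simp)
        rcases Finset.mem_insert.1 hy with rfl | hy
        · simp
        · have := hsub y hy
          simp only [Finset.mem_insert, Finset.mem_singleton]
          tauto
      · refine mem_faces_of_subset hdac (fun y hy => ?_) (by simp)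
        rcases Finset.mem_insert.1 hy with rfl | hy
        · simp
        · have := hsub y hy
          simp only [Finset.mem_insert, Finset.mem_singleton]
          tauto
      · refine mem_faces_of_subset hdab (fun y hy => ?_) (by simp)
        rcases Finset.mem_insert.1 hy with rfl | hy
        · simp
        · have := hsub y hy
          simp only [Finset.mem_insert, Finset.mem_singleton]
          tauto
    have hpre : ∀ r : Finset α, r.Nonempty → r ⊂ {a, b, c} → r ∈ T.faces := fun r hr hrt =>
      mem_faces_of_subset (hstar r hrt) (Finset.subset_insert _ _) hr
    have hdt : d ∉ ({a, b, c} : Finset α) := by simp [h1, h2, h3]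
    -- The result of the inverse T-move: the open star of `d` is replaced with a triangle.
    let K : PreAbstractSimplicialComplex α :=
      { faces := {s | (s ∈ T.faces ∧ d ∉ s) ∨ s = {a, b, c}}
        isRelLowerSet_faces := by
          rintro s (⟨hs, hds⟩ | rfl)
          · exact ⟨nonempty_of_mem_faces hs, fun r hrs hr =>
              Or.inl ⟨mem_faces_of_subset hs hrs hr, fun h => hds (hrs h)⟩⟩
          · refine ⟨by simp, fun r hrs hr => ?_⟩
            rcases eq_or_ssubset_of_subset hrs with h | h
            · exact Or.inr h
            · exact Or.inl ⟨hpre r hr h, fun hd => hdt (hrs hd)⟩ }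
    refine hT.2 K ⟨{a, b, c}, ⟨Or.inr rfl, Finset.card_eq_three.2 ⟨a, b, c, hab, hac, hbc, rfl⟩⟩,
      d, ?_, fun s => ⟨fun hs => ?_, ?_⟩⟩
    · rintro (⟨-, h⟩ | h)
      · simp at h
      · exact hdt (by rw [← h]; simp)
    · by_cases hds : d ∈ s
      · refine Or.inr ⟨s.erase d, Finset.ssubset_iff_subset_ne.2 ⟨fun x hx => ?_, fun h => ?_⟩,
          (Finset.insert_erase hds).symm⟩
        · obtain ⟨hxd, hxs⟩ := Finset.mem_erase.1 hx
          have : x ∈ T.neighbors d := ⟨hxd, mem_faces_of_subset hs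
            (by simp [Finset.insert_subset_iff, hds, hxs]) (by simp)⟩
          simpa using hNd this
        · exact habc (h ▸ mem_faces_of_subset hs (Finset.erase_subset _ _) (by rw [h]; simp))
      · exact Or.inl ⟨Or.inl ⟨hs, hds⟩, fun h => habc (h ▸ hs)⟩
    · rintro (⟨⟨hs, -⟩ | hs, hne⟩ | ⟨r, hr, rfl⟩)
      exacts [hs, absurd hs hne, hstar r hr]

/-! ### Minimal decompositions of small roots -/

lemma IsMinimalDecomposition.eq_empty_or_eq_singleton (hmin : T.IsMinimalDecomposition G D Ds)
    (hroot : T.IsRoot) (hcard : T.vertices.ncard ≤ 11) :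
    Ds = ∅ ∨ ∃ D₁ : PreAbstractSimplicialComplex α, Ds = {D₁} ∧
      (D₁.triangles.ncard = 1 ∨ D₁.triangles.ncard = 2) := by
  have hT := hroot.1
  have hdec := hmin.1
  have hfin := vertices_finite hT.1.finite
  have hχ2 := hT.1.eulerCharacteristic_le_two
  by_cases hχ : T.eulerCharacteristic = 2
  · left
    obtain ⟨G', D', hdec', hG'⟩ := hT.exists_isDecomposition_of_sphere hχ
    exact hdec.eq_empty_of_ncard_triangles_le_one hT (hG' ▸ hmin.2 _ _ _ hdec')
  rcases Ds.eq_empty_or_nonempty with hDs | ⟨E, hE⟩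
  · exact Or.inl hDs
  right
  obtain ⟨v, hv, hvD⟩ := hdec.exists_maxValence
  have hval : T.valence v < D.vertices.ncard := hvD.valence_lt hT hdec.main_le
  have hsub : ∀ {F}, F = D ∨ F ∈ Ds → F.vertices ⊆ T.vertices :=
    fun hF => vertices_mono (hdec.le_of_disc hF)
  have hdisj : ∀ {F}, F ∈ Ds → Disjoint D.vertices F.vertices := fun hF =>
    disjoint_vertices (hdec.disjoint hT (Or.inl rfl) (Or.inr hF) (hdec.main_ne hF))
  have hDfin := hfin.subset (hsub (Or.inl rfl))
  have hEfin := hfin.subset (hsub (Or.inr hE))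
  have hDE : D.vertices.ncard + E.vertices.ncard ≤ T.vertices.ncard := by
    rw [← Set.ncard_union_eq (hdisj hE) hDfin hEfin]
    exact Set.ncard_le_ncard (Set.union_subset (hsub (Or.inl rfl)) (hsub (Or.inr hE))) hfin
  have hE3 := (hdec.disc_disc E hE).1.three_le_ncard_vertices
  have hD3 := hdec.main_disc.1.three_le_ncard_vertices
  -- Valences at most five would leave at most `6χ ≤ 6` vertices, which is too few for the closed
  -- star of a vertex of maximal valence and a disjoint disc.
  have hsix : 6 ≤ T.valence v := by
    by_contra hlt
    have h5 := hT.le_six_mul_eulerCharacteristic hv.2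
    have hmul : (T.vertices.ncard : ℤ) ≤ (6 - T.valence v : ℤ) * T.vertices.ncard :=
      le_mul_of_one_le_left (by positivity) (by omega)
    have hle : T.vertices.ncard ≤ 6 := by omega
    have hm : T.valence v ≤ 2 := by omega
    have hmul' : (4 * T.vertices.ncard : ℤ) ≤ (6 - T.valence v : ℤ) * T.vertices.ncard :=
      mul_le_mul_of_nonneg_right (by omega) (by positivity)
    omega
  have hEuniq : Ds = {E} := by
    refine Finset.eq_singleton_iff_unique_mem.2 ⟨hE, fun F hF => ?_⟩
    by_contra hFE
    have hF3 := (hdec.disc_disc F hF).1.three_le_ncard_vertices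
    have hFfin := hfin.subset (hsub (Or.inr hF))
    have hEF := disjoint_vertices (hdec.disjoint hT (Or.inr hE) (Or.inr hF) (Ne.symm hFE))
    have h := Set.ncard_le_ncard (Set.union_subset (Set.union_subset (hsub (Or.inl rfl))
      (hsub (Or.inr hE))) (hsub (Or.inr hF))) hfin
    rw [Set.ncard_union_eq (Set.disjoint_union_left.2 ⟨hdisj hF, hEF⟩) (hDfin.union hEfin) hFfin,
      Set.ncard_union_eq (hdisj hE) hDfin hEfin] at h
    omega
  refine ⟨E, hEuniq, ?_⟩
  rcases (hdec.disc_disc E hE).ncard_triangles_of_ncard_vertices_le_four (by omega) with h | h | ⟨h3, h4⟩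
  · exact Or.inl h
  · exact Or.inr h
  · exfalso
    obtain ⟨d, a, b, c, hab, hac, hbc, hda, hb, hc, hbc'⟩ :=
      exists_star_of_ncard_triangles (hdec.disc_disc E hE).1.finite h4 h3
    have hle := hdec.disc_le E hE
    exact hroot.not_star (by omega) hab hac hbc hda (apexes_mono hle hb) (apexes_mono hle hc)
      (apexes_mono hle hbc')

end PreAbstractSimplicialComplex

theorem mainTheorem2 {α : Type*} [DecidableEq α]
    (T : PreAbstractSimplicialComplex α)
    (hroot : T.IsRoot)
    (hcard : T.vertices.ncard ≤ 11)
    (G D : PreAbstractSimplicialComplex α)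
    (Ds : Finset (PreAbstractSimplicialComplex α))
    (hmin : PreAbstractSimplicialComplex.IsMinimalDecomposition T G D Ds) :
    Ds = ∅ ∨
      ∃ D₁ : PreAbstractSimplicialComplex α, Ds = {D₁} ∧
        (D₁.triangles.ncard = 1 ∨ D₁.triangles.ncard = 2) :=
  hmin.eq_empty_or_eq_singleton hroot hcard
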